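/- **Setting.** A *program* $\pi$ is a finite set of rules $C(X)\leftarrow \bigcirc^{k_1}R_1(\bar U_1)\wedge\dots\wedge\bigcirc^{k_s}R_s(\bar U_s)$ with $k_i\in\mathbb Z$, where $\bigcirc^{k}$ means "$k$ moments later" ("$|k|$ moments earlier" if $k<0$), heads are unary, all relations have positive arity and $X$ occurs in the body. Relations occurring in heads are IDB, all others are EDB. The pair $(\pi,G)$ is a *(connected) $\textsl{datalog}_{lm}^{\bigcirc}$ query* if $G$ is an IDB relation, every rule body contains at most one IDB atom, and for every rule body the graph on its variables, in which two variables are adjacent if they share an atom, is connected. The size $|\pi|$ is the number of symbols of $\pi$, where $\bigcirc^k$ counts as $|k|$ symbols. For a temporal database $\mathcal D$ (a set of EDB atoms at each moment $\ell\in\mathbb Z$, with a set $\Delta$ of objects), a *model* of $\pi$ and $\mathcal D$ is obtained by adding, at any moments, IDB atoms over $\Delta$ so that all rules of $\pi$ hold at all $\ell\in\mathbb Z$ for all assignments of objects to variables. We write $\mathcal D,\pi,\ell\models C(d)$ if $C(d)$ holds at $\ell$ in every model of $\pi$ and $\mathcal D$. A rule body with answer variable $X$ and IDB atom $\bigcirc^kE(Y)$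 is *vertical* if $Y\ne X$; all other rule bodies (including those without IDB atom) are *horizontal*. Let $\Gamma$ be the set of rule bodies of $\pi$ and $\Omega=2^{\Gamma\cup\{\bot,\top\}}$. Letters $\{B\}$ with $B$ a vertical body are *vertical*, all other letters are *horizontal*; *segments* of a word over $\Omega$ are its maximal blocks of vertical, respectively horizontal, letters. A word $\alpha\in\Omega^*$ is *correct* if its horizontal letters contain no vertical bodies, every horizontal segment has exactly one letter containing $\bot$, and every horizontal segment followed by a vertical one has exactly one letter containing $\top$. A correct $\alpha$ describes a temporal database $\mathcal D_\alpha$: reading $\alpha$ from the left, start with the object $X$ at time $0$. In a vertical letter $\{B\}$ reached with object $d$ at time $t$, where $B$ has the IDB atom $\bigcirc^kE(Y)$, add the EDB atoms of $B$ at times relative to $t$, with $d$ for the answer variable and fresh objects for all other variables, and continue with the object for $Y$ at time $t+k$. In a horizontal segment reached with $d$ at time $t$, whose letters with $\bot$ and $\top$ have positions $j_\bot$ and $j_\top$, add for each position $j$ and each body $B$ in the $j$-th letter the EDB atoms of $B$ at times relative to $t+j-j_\bot$, with $d$ for the answer variable and fresh objects for all other variables of $B$; if a vertical segment follows, continue with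 $d$ at time $t+j_\top-j_\bot$. The objects of $\mathcal D_\alpha$ are $X$ and all objects so introduced. Let $\textit{Accept}(\pi,G)\subseteq\Omega^*$ be the set of correct words $\alpha$ with $\mathcal D_\alpha,\pi,0\models G(X)$, and let $\textit{NotAccept}(\pi,G)=\Omega^*\setminus\textit{Accept}(\pi,G)$. **Statement.** There is a polynomial $p$ such that for every connected $\textsl{datalog}_{lm}^{\bigcirc}$ query $(\pi,G)$ the following hold: $\textit{NotAccept}(\pi,G)$ is a regular language over $\Omega$; $\textit{Accept}(\pi,G)$ is a regular language over $\Omega$; and $\textit{NotAccept}(\pi,G)$ is recognised by a nondeterministic finite automaton with at most $2^{p(|\pi|)}$ states. -/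

import Mathlib

open scoped Polynomial

namespace TDatalog

/-! ### Syntax of monadic temporal datalog with the operators "next" and "previous" -/

/-- A temporalised atom `○^shift rel(args)`; negative powers stand for "previous moment".
Variables are natural numbers. -/
structure Atom (R : Type*) where
  shift : ℤ
  rel : R
  args : List ℕ

/-- A rule body: a conjunction of temporalised atoms, with its answer variable `X = ans`. -/
structure Body (R : Type*) where
  ans : ℕ
  atoms : List (Atom R)

/-- The monadic rule `head(X) ← body`, where `X` is the answer variable of the body. -/
structure Rule (R : Type*) where
  head : R
  body : Body R

abbrev Program (R : Type*) := Finset (Rule R)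

variable {R : Type*}

/-- The variables of a body. -/
def Body.vars (B : Body R) : Set ℕ := {v | ∃ a ∈ B.atoms, v ∈ a.args}

/-- The Gaifman graph of a body. -/
def Body.gaifman (B : Body R) : SimpleGraph {v // v ∈ B.vars} where
  Adj u v := u ≠ v ∧ ∃ a ∈ B.atoms, (u : ℕ) ∈ a.args ∧ (v : ℕ) ∈ a.args
  symm := ⟨fun _ _ h => ⟨h.1.symm, by obtain ⟨a, ha, hu, hv⟩ := h.2; exact ⟨a, ha, hv, hu⟩⟩⟩
  loopless := ⟨fun _ h => h.1 rfl⟩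

/-- The number of symbols of an atom: `|k|` for `○^k`, one for the relation symbol, one for
each variable occurrence. -/
def Atom.size (a : Atom R) : ℕ := a.shift.natAbs + 1 + a.args.length

/-- The number of symbols of a rule: two for the head, one for the arrow, those of the atoms of
the body, and the conjunction signs between them. -/
def Rule.size (r : Rule R) : ℕ :=
  3 + (r.body.atoms.map Atom.size).sum + (r.body.atoms.length - 1)

/-- The size `|π|` of a program. -/
def Program.size (π : Program R) : ℕ := ∑ r ∈ π, r.size

/-- The IDB relations of `π` are those in rule heads; all other relations are EDB. -/
def Program.IsIDB (π : Program R) (S : R) : Prop := ∃ r ∈ π, r.head = S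

open Classical in
/-- `(π, G)` is a connected linear monadic temporal datalog query that uses the operators
"next" and "previous" only, over a schema with arities `ar`. Relations have positive arity. -/
structure IsQuery (ar : R → ℕ) (π : Program R) (G : R) : Prop where
  monadic : ∀ r ∈ π, ar r.head = 1
  arity : ∀ r ∈ π, ∀ a ∈ r.body.atoms, a.args.length = ar a.rel
  arity_pos : ∀ r ∈ π, ∀ a ∈ r.body.atoms, 0 < ar a.rel
  safe : ∀ r ∈ π, r.body.ans ∈ r.body.vars
  linear : ∀ r ∈ π, r.body.atoms.countP (fun a => decide (π.IsIDB a.rel)) ≤ 1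
  connected : ∀ r ∈ π, r.body.gaifman.Connected
  goal : π.IsIDB G

/-! ### Temporal databases, models and certain answers -/

/-- A temporal database, possibly infinite in time, with a set `dom` of objects `O`; the slice
at time `ℓ` is a set of ground atoms. -/
structure TDB (R O : Type*) where
  dom : Set O
  slice : ℤ → Set (R × List O)

/-- `E, ℓ ⊨ B(ν)`: the body holds at time `ℓ` under the assignment `ν`. -/
def TDB.Sat {O : Type*} (E : TDB R O) (l : ℤ) (B : Body R) (ν : ℕ → O) : Prop :=
  ∀ a ∈ B.atoms, (a.rel, a.args.map ν) ∈ E.slice (l + a.shift)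

/-- `E` is an enrichment of `D`: it has the same objects and the same EDB atoms. -/
structure IsEnrichment {O : Type*} (π : Program R) (D E : TDB R O) : Prop where
  dom_eq : E.dom = D.dom
  objects : ∀ l, ∀ f ∈ E.slice l, ∀ d ∈ f.2, d ∈ E.dom
  edb : ∀ l S ds, ¬ π.IsIDB S → ((S, ds) ∈ E.slice l ↔ (S, ds) ∈ D.slice l)

/-- `E` is a model of `π` and `D`. -/
structure IsModel {O : Type*} (π : Program R) (D E : TDB R O) : Prop where
  enrichment : IsEnrichment π D E
  rules : ∀ r ∈ π, ∀ (l : ℤ) (ν : ℕ → O), (∀ v ∈ r.body.vars, ν v ∈ E.dom) →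
    E.Sat l r.body ν → (r.head, [ν r.body.ans]) ∈ E.slice l

/-- `D, π, ℓ ⊨ C(d)`. -/
def Certain {O : Type*} (D : TDB R O) (π : Program R) (l : ℤ) (C : R) (d : O) : Prop :=
  ∀ E : TDB R O, IsModel π D E → (C, [d]) ∈ E.slice l

/-! ### The alphabet of database descriptions -/

section Alphabet

variable (π : Program R)

/-- The rule bodies of `π` (recursive and initialisation ones). -/
def Program.bodies : Set (Body R) := {B | ∃ r ∈ π, r.body = B}

open Classical in
/-- The IDB atom of a rule body (`none` for the body of an initialisation rule). -/
noncomputable def Body.idbAtom (B : Body R) : Option (Atom R) :=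
  B.atoms.find? (fun a => decide (π.IsIDB a.rel))

/-- The variable `Y` of the IDB atom `○^k E(Y)` of a recursive body. For the body of an
initialisation rule this is the answer variable, by convention. -/
noncomputable def Body.exitVar (B : Body R) : ℕ :=
  ((B.idbAtom π).bind fun a => a.args.head?).getD B.ans

/-- The number `k` of the IDB atom `○^k E(Y)` of a recursive body. -/
noncomputable def Body.exitShift (B : Body R) : ℤ :=
  ((B.idbAtom π).map Atom.shift).getD 0

/-- Vertical bodies are the recursive ones with `Y ≠ X`. The other bodies, including those of
the initialisation rules, stand in horizontal letters. -/
def Body.Vertical (B : Body R) : Prop := B.exitVar π ≠ B.ans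

/-- The elements of letters: rule bodies of `π` and the two markers `⊥` and `⊤`. -/
inductive Symb where
  | body (B : {B : Body R // B ∈ π.bodies}) : Symb
  | bot : Symb
  | top : Symb

/-- The alphabet `Ω`: all sets of rule bodies and markers. -/
abbrev Omega := Set (Symb π)

variable {π}

/-- Vertical letters `{B}`, for a vertical body `B`; all other letters are horizontal. -/
def VertLetter (L : Omega π) : Prop :=
  ∃ B : {B : Body R // B ∈ π.bodies}, B.1.Vertical π ∧ L = {Symb.body B}

/-- Letters that may occur in a correct word: vertical letters, and sets of non-vertical bodies
and markers. -/
def CorrectLetter (L : Omega π) : Prop :=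
  VertLetter L ∨ ∀ B : {B : Body R // B ∈ π.bodies}, Symb.body B ∈ L → ¬ B.1.Vertical π

open Classical in
/-- The maximal blocks of vertical and of horizontal letters of a word, in their order. -/
noncomputable def segments (w : List (Omega π)) : List (List (Omega π)) :=
  w.splitBy (fun L L' => decide (VertLetter L ↔ VertLetter L'))

/-- A horizontal segment: a segment without vertical letters. -/
def HorizSegment (σ : List (Omega π)) : Prop := ∀ L ∈ σ, ¬ VertLetter L

open Classical in
/-- Correct words: every horizontal segment has exactly one `⊥`, and every horizontal segment
that is followed by a vertical one has exactly one `⊤`. -/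
structure Correct (w : List (Omega π)) : Prop where
  letters : ∀ L ∈ w, CorrectLetter L
  bot : ∀ σ ∈ segments w, HorizSegment σ →
    σ.countP (fun L => decide (Symb.bot ∈ L)) = 1
  top : ∀ s σ τ s', segments w = s ++ σ :: τ :: s' → HorizSegment σ →
    σ.countP (fun L => decide (Symb.top ∈ L)) = 1

/-! ### The temporal database described by a word -/

open Classical in
/-- The number `k` of the IDB atom `○^k E(Y)` in the body of a vertical letter. -/
noncomputable def letterShift (L : Omega π) : ℤ :=
  if h : VertLetter L then h.choose.1.exitShift π else 0

open Classical in
/-- The position of the first letter with the given marker. -/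
noncomputable def markerIdx (s : Symb π) (σ : List (Omega π)) : ℕ :=
  σ.findIdx (fun L => decide (s ∈ L))

open Classical in
/-- The time at which the `j`-th letter of a segment is placed, relative to the time at which
the segment is attached: the sum of the preceding shifts in a vertical segment, and the
distance from the letter with `⊥` in a horizontal one. -/
noncomputable def letterOffset (σ : List (Omega π)) (j : ℕ) : ℤ :=
  if HorizSegment σ then (j : ℤ) - markerIdx Symb.bot σ
  else ((σ.take j).map letterShift).sum

open Classical in
/-- The time at which the next segment is attached, relative to the time at which this one is:
after all shifts for a vertical segment, and at the letter with `⊤` for a horizontal one. -/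
noncomputable def exitOffset (σ : List (Omega π)) : ℤ :=
  if HorizSegment σ then (markerIdx Symb.top σ : ℤ) - markerIdx Symb.bot σ
  else (σ.map letterShift).sum

/-- The times of the letters of a sequence of segments that is attached at time `t`. -/
noncomputable def letterTimes : List (List (Omega π)) → ℤ → List ℤ
  | [], _ => []
  | σ :: s, t =>
      (List.range σ.length).map (fun j => t + letterOffset σ j) ++
        letterTimes s (t + exitOffset σ)

/-- The objects of the described database, that is, the variables of the query `Q_w`:
`node h` is the variable reached after `h` vertical letters (so `node 0` is the answer
variable `X`), and `loc i B v` is the private copy of the variable `v` of the body `B` in the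
`i`-th letter. -/
inductive Obj (R : Type*) where
  | node (h : ℕ) : Obj R
  | loc (i : ℕ) (B : Body R) (v : ℕ) : Obj R

open Classical in
/-- The number of vertical letters of a word. -/
noncomputable def height (w : List (Omega π)) : ℕ := w.countP (fun L => decide (VertLetter L))

/-- The object for the variable `v` of the body `B` in the `i`-th letter of `w`: the answer
variable is shared with the preceding letters of the composition, the variable of the IDB atom
of a vertical body with the following ones, and all other variables are fresh. -/
noncomputable def objOf (w : List (Omega π)) (i : ℕ) (B : Body R) (v : ℕ) : Obj R :=
  if v = B.ans then Obj.node (height (w.take i))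
  else if v = B.exitVar π then Obj.node (height (w.take i) + 1)
  else Obj.loc i B v

/-- `Occurs w i t B`: the body `B` belongs to the `i`-th letter of `w`, which is placed at
time `t`. -/
def Occurs (w : List (Omega π)) (i : ℕ) (t : ℤ) (B : Body R) : Prop :=
  (letterTimes (segments w) 0)[i]? = some t ∧
    ∃ L, w[i]? = some L ∧ ∃ hB : B ∈ π.bodies, Symb.body ⟨B, hB⟩ ∈ L

/-- The temporal database `D_w` over the EDB schema that is described by a word `w`: its objects
are the variables of `Q_w`, and it has the atoms of all bodies in `w` without the IDB ones. -/
def wordDB (w : List (Omega π)) : TDB R (Obj R) where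
  dom := {Obj.node 0} ∪ {o | ∃ i t B, Occurs w i t B ∧ ∃ v ∈ B.vars, o = objOf w i B v}
  slice l := {f | ∃ i t B, Occurs w i t B ∧ ∃ a ∈ B.atoms, ¬ π.IsIDB a.rel ∧
    l = t + a.shift ∧ f = (a.rel, a.args.map (objOf w i B))}

end Alphabet

/-- The language `Accept(π, G)`: the correct words `w` with `D_w, π, 0 ⊨ G(X)`. -/
def Accept (π : Program R) (G : R) : Language (Omega π) :=
  {w | Correct w ∧ Certain (wordDB w) π 0 G (Obj.node 0)}

/-- The language `NotAccept(π, G)`: the complement of `Accept(π, G)` in `Ω^*`. -/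
def NotAccept (π : Program R) (G : R) : Language (Omega π) := (Accept π G)ᶜ

end TDatalog

/-!
The two languages are regular by the theorem of Myhill and Nerode: `invariant` maps every prefix
`u` to an element of a finite set with `2 ^ poly(|π|)` elements, and whether `u ++ v` is accepted
depends only on the invariant of `u` and on `v` (`accept_of_invariant_eq`). The left quotients of
`NotAccept π G` are then the states of a small automaton (`exists_nfa_of_invariant`,
`card_invariant_le`).

Since every rule has at most one IDB atom, a certain answer is witnessed by a *path* of rule
applications between facts `S(o)` at moments (`IsQuery.certain_iff`). Correctness of a word is a
matter of counting markers in the current segment, so it remains to see how paths over the database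
of `u ++ v` depend on `u`. This database is composed of copies of rule bodies that are attached at
nodes and moments (`placedDB`, `derives_wordDB_iff`). The bodies of `u` and those of `v` share a
single node `h`, the object reached last. In time, the bodies of `v` meet those of `u` at most
around two moments of `h`: the moment `T` of the current letter and, if the marker `⊤` has been
read in the current segment, the moment `P` of this marker, where the rest of the word is attached.

Rule bodies are connected and have at most `|π|` variables and shifts of at most `|π|` moments.
Hence a rule application that touches the part `v` touches the part `u` only within a window of
polynomial size around `h` at `T` or `P` (`Replacement.fires_shift`), and a path alternates between
such applications and stretches inside `u` whose ends belong to a set of polynomially many named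
moment-objects. If `u` is replaced by `u'`, the former can be copied as soon as the windows look
the same, and the latter can be simulated as soon as the same pairs of named moment-objects are
connected by paths (`transfer_path`, `Replacement.derives`). This is what the invariant `data`
records: the bodies in the windows and the reachability relation between named moment-objects. When
`T` and `P` are close, their windows overlap and are treated as one; then also `T - P` is recorded
(`CutContext.derives`).

A complication arises when `u` ends inside a horizontal segment whose marker `⊥` has not been read
yet, because then the distance in time between this segment and the earlier ones depends on `v`. In
this case the current segment on the one hand, and all before it on the other hand, are replaced
separately (`derives_replace_no_bot`, `derives_replace_vert`); otherwise `u` is replaced as a whole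
(`derives_replace_bot`).
-/

/-! ### Derivations as paths -/

namespace TDatalog

variable {R : Type*} {O O' : Type*}

/-- Ground IDB facts `S(o)` at a moment `l`, as triples `(S, o, l)`. IDB relations are unary. -/
abbrev Fact (R O : Type*) := R × O × ℤ

section Graph

variable (π : Program R)

/-- The EDB atoms of the body `B` hold in `D` at the moment `l` under the assignment `ν`. -/
def Fires (D : ℤ → Set (R × List O)) (B : Body R) (ν : ℕ → O) (l : ℤ) : Prop :=
  ∀ a ∈ B.atoms, ¬ π.IsIDB a.rel → (a.rel, a.args.map ν) ∈ D (l + a.shift)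

/-- `Step π D f g`: some recursive rule derives the fact `f` from the fact `g` over `D`. -/
def Step (D : ℤ → Set (R × List O)) (f g : Fact R O) : Prop :=
  ∃ r ∈ π, ∃ ν : ℕ → O, r.head = f.1 ∧ ν r.body.ans = f.2.1 ∧ Fires π D r.body ν f.2.2 ∧
    ∃ a, r.body.idbAtom π = some a ∧ a.rel = g.1 ∧ ν (r.body.exitVar π) = g.2.1 ∧
      f.2.2 + a.shift = g.2.2

/-- Some rule without IDB atom derives the fact `f` over `D`. -/
def Init (D : ℤ → Set (R × List O)) (f : Fact R O) : Prop :=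
  ∃ r ∈ π, ∃ ν : ℕ → O, r.head = f.1 ∧ ν r.body.ans = f.2.1 ∧ Fires π D r.body ν f.2.2 ∧
    r.body.idbAtom π = none

/-- For a linear program a derivation is a path of recursive rule applications that ends with an
initialisation rule. -/
def Derives (D : ℤ → Set (R × List O)) (f : Fact R O) : Prop :=
  ∃ g, Relation.ReflTransGen (Step π D) f g ∧ Init π D g

end Graph

variable {π : Program R} {ar : R → ℕ} {G : R}

theorem Derives.step {D : ℤ → Set (R × List O)} {f g : Fact R O} (h : Step π D f g)
    (hg : Derives π D g) : Derives π D f := by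
  obtain ⟨k, hk, hi⟩ := hg
  exact ⟨k, .head h hk, hi⟩

theorem eq_of_countP_le_one {α : Type*} {p : α → Bool} {l : List α} (h : l.countP p ≤ 1)
    {a b : α} (ha : a ∈ l) (hb : b ∈ l) (hpa : p a) (hpb : p b) : a = b := by
  rw [List.countP_eq_length_filter] at h
  have ha' : a ∈ l.filter p := List.mem_filter.2 ⟨ha, hpa⟩
  have hb' : b ∈ l.filter p := List.mem_filter.2 ⟨hb, hpb⟩
  match hl : l.filter p, h with
  | [], _ => simp [hl] at ha'
  | [c], _ => rw [hl, List.mem_singleton] at ha' hb'; rw [ha', hb']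

theorem idbAtom_some {B : Body R} {a : Atom R} (h : B.idbAtom π = some a) :
    a ∈ B.atoms ∧ π.IsIDB a.rel := by
  unfold Body.idbAtom at h
  exact ⟨List.mem_of_find?_eq_some h, by simpa using List.find?_some h⟩

theorem idbAtom_none {B : Body R} (h : B.idbAtom π = none) {a : Atom R} (ha : a ∈ B.atoms) :
    ¬ π.IsIDB a.rel := by
  unfold Body.idbAtom at h
  simpa using List.find?_eq_none.1 h a ha

theorem IsQuery.idbAtom_unique (hq : IsQuery ar π G) {r : Rule R} (hr : r ∈ π) {a b : Atom R}
    (h : r.body.idbAtom π = some a) (hb : b ∈ r.body.atoms) (hbi : π.IsIDB b.rel) : b = a := by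
  classical
  refine eq_of_countP_le_one (p := fun a => decide (π.IsIDB a.rel)) ?_ hb (idbAtom_some h).1
    (by simpa using hbi) (by simpa using (idbAtom_some h).2)
  convert hq.linear r hr

theorem IsQuery.args_eq (hq : IsQuery ar π G) {r : Rule R} (hr : r ∈ π) {a : Atom R}
    (h : r.body.idbAtom π = some a) : a.args = [r.body.exitVar π] := by
  obtain ⟨ha, r', hr', he⟩ := idbAtom_some h
  have h1 : a.args.length = 1 := by rw [hq.arity r hr a ha, ← he, hq.monadic r' hr']
  obtain ⟨y, hy⟩ := List.length_eq_one_iff.1 h1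
  simp [Body.exitVar, h, hy]

theorem IsQuery.args_ne_nil (hq : IsQuery ar π G) {r : Rule R} (hr : r ∈ π) {a : Atom R}
    (ha : a ∈ r.body.atoms) : ∃ v, v ∈ a.args := by
  refine List.exists_mem_of_length_pos ?_
  rw [hq.arity r hr a ha]
  exact hq.arity_pos r hr a ha

theorem IsQuery.exitVar_mem (hq : IsQuery ar π G) {r : Rule R} (hr : r ∈ π) :
    r.body.exitVar π ∈ r.body.vars := by
  cases h : r.body.idbAtom π with
  | none => simpa [Body.exitVar, h] using hq.safe r hr
  | some a => exact ⟨a, (idbAtom_some h).1, by simp [hq.args_eq hr h]⟩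

/-- Certain answers are the derivable ones, because the derivable facts form a model. -/
theorem IsQuery.certain_iff (hq : IsQuery ar π G) {D : TDB R O} (hedb : ∀ l S ds,
    (S, ds) ∈ D.slice l → ∀ d ∈ ds, d ∈ D.dom) {l : ℤ} {C : R} {d : O} (hC : π.IsIDB C) :
    Certain D π l C d ↔ Derives π D.slice (C, d, l) := by
  constructor
  · intro h
    let E : TDB R O :=
      { dom := D.dom
        slice := fun l => {f | (¬ π.IsIDB f.1 ∧ f ∈ D.slice l) ∨
          (π.IsIDB f.1 ∧ ∃ o, f.2 = [o] ∧ o ∈ D.dom ∧ Derives π D.slice (f.1, o, l))} }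
    have hE : IsModel π D E := by
      refine ⟨⟨rfl, ?_, ?_⟩, ?_⟩
      · rintro l ⟨S, ds⟩ (⟨-, h⟩ | ⟨-, o, rfl, ho, -⟩) d hd
        · exact hedb _ _ _ h d hd
        · rw [List.mem_singleton] at hd
          exact hd ▸ ho
      · intro l S ds hS
        simp [E, hS]
      · intro r hr l ν hν hsat
        have hi : π.IsIDB r.head := ⟨r, hr, rfl⟩
        refine Or.inr ⟨hi, _, rfl, hν _ (hq.safe r hr), ?_⟩
        have hf : Fires π D.slice r.body ν l := by
          intro a ha hna
          rcases hsat a ha with h | h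
          · exact h.2
          · exact absurd h.1 hna
        cases ha : r.body.idbAtom π with
        | none => exact ⟨_, .refl, r, hr, ν, rfl, rfl, hf, ha⟩
        | some a =>
          have hmem := idbAtom_some ha
          rcases hsat a hmem.1 with h | ⟨-, o, ho, -, hd⟩
          · exact absurd hmem.2 h.1
          · rw [hq.args_eq hr ha] at ho
            simp only [List.map_cons, List.map_nil, List.cons.injEq, and_true] at ho
            exact Derives.step ⟨r, hr, ν, rfl, rfl, hf, a, ha, rfl, ho, rfl⟩ hd
    rcases h E hE with h | ⟨-, o, ho, -, hd⟩
    · exact absurd hC h.1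
    · simp only [List.cons.injEq, and_true] at ho
      exact ho ▸ hd
  · rintro ⟨g, hg, hi⟩ E hE
    have fires : ∀ {r : Rule R}, r ∈ π → ∀ {ν : ℕ → O} {l : ℤ}, Fires π D.slice r.body ν l →
        (∀ a, r.body.idbAtom π = some a →
          (a.rel, [ν (r.body.exitVar π)]) ∈ E.slice (l + a.shift)) →
        (r.head, [ν r.body.ans]) ∈ E.slice l := by
      intro r hr ν l hf ha
      have hsat : E.Sat l r.body ν := by
        intro b hb
        by_cases hbi : π.IsIDB b.rel
        · cases h : r.body.idbAtom π with
          | none => exact absurd hbi (idbAtom_none h hb)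
          | some a =>
            obtain rfl := hq.idbAtom_unique hr h hb hbi
            simpa [hq.args_eq hr h] using ha b h
        · exact (hE.enrichment.edb _ _ _ hbi).2 (hf b hb hbi)
      refine hE.rules r hr l ν ?_ hsat
      rintro v ⟨a, ha, hv⟩
      exact hE.enrichment.objects _ _ (hsat a ha) _ (List.mem_map_of_mem hv)
    suffices (C, [d]) ∈ E.slice l from this
    have key : ∀ f : Fact R O, Relation.ReflTransGen (Step π D.slice) f g →
        (f.1, [f.2.1]) ∈ E.slice f.2.2 := by
      intro f hf
      induction hf using Relation.ReflTransGen.head_induction_on with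
      | refl =>
        obtain ⟨r, hr, ν, h1, h2, h3, h4⟩ := hi
        rw [← h1, ← h2]
        exact fires hr h3 (by simp [h4])
      | head hs _ ih =>
        obtain ⟨r, hr, ν, h1, h2, h3, a, h4, h5, h6, h7⟩ := hs
        rw [← h1, ← h2]
        refine fires hr h3 fun b hb => ?_
        obtain rfl := Option.some.inj (h4.symm.trans hb)
        rw [h5, h6, h7]
        exact ih
    exact key _ hg

/-! ### Homomorphisms that shift time -/

section Hom

variable {D : ℤ → Set (R × List O)} {D' : ℤ → Set (R × List O')} {φ : O → O'} {b : ℤ}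

theorem Fires.map (h : ∀ l S ds, (S, ds) ∈ D l → (S, ds.map φ) ∈ D' (l + b)) {B : Body R}
    {ν : ℕ → O} {l : ℤ} (hf : Fires π D B ν l) : Fires π D' B (φ ∘ ν) (l + b) := by
  intro a ha hn
  have := h _ _ _ (hf a ha hn)
  rwa [List.map_map, add_right_comm] at this

theorem Step.map (h : ∀ l S ds, (S, ds) ∈ D l → (S, ds.map φ) ∈ D' (l + b)) {f g : Fact R O}
    (hs : Step π D f g) :
    Step π D' (f.1, φ f.2.1, f.2.2 + b) (g.1, φ g.2.1, g.2.2 + b) := by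
  obtain ⟨r, hr, ν, h1, h2, h3, a, h4, h5, h6, h7⟩ := hs
  exact ⟨r, hr, φ ∘ ν, h1, congrArg φ h2, h3.map h, a, h4, h5, congrArg φ h6,
    by rw [← h7]; ring⟩

theorem Init.map (h : ∀ l S ds, (S, ds) ∈ D l → (S, ds.map φ) ∈ D' (l + b)) {f : Fact R O}
    (hs : Init π D f) : Init π D' (f.1, φ f.2.1, f.2.2 + b) := by
  obtain ⟨r, hr, ν, h1, h2, h3, h4⟩ := hs
  exact ⟨r, hr, φ ∘ ν, h1, congrArg φ h2, h3.map h, h4⟩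

theorem Derives.map (h : ∀ l S ds, (S, ds) ∈ D l → (S, ds.map φ) ∈ D' (l + b)) {f : Fact R O}
    (hd : Derives π D f) : Derives π D' (f.1, φ f.2.1, f.2.2 + b) := by
  obtain ⟨g, hg, hi⟩ := hd
  exact ⟨_, hg.lift (fun f => (f.1, φ f.2.1, f.2.2 + b)) fun _ _ => Step.map h, hi.map h⟩

end Hom

theorem Fires.mono {D D' : ℤ → Set (R × List O)} (h : ∀ l, D l ⊆ D' l) {B : Body R}
    {ν : ℕ → O} {l : ℤ} (hf : Fires π D B ν l) : Fires π D' B ν l :=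
  fun a ha hn => h _ (hf a ha hn)

theorem Step.mono {D D' : ℤ → Set (R × List O)} (h : ∀ l, D l ⊆ D' l) {f g : Fact R O}
    (hs : Step π D f g) : Step π D' f g := by
  obtain ⟨r, hr, ν, h1, h2, h3, h4⟩ := hs
  exact ⟨r, hr, ν, h1, h2, h3.mono h, h4⟩

theorem Derives.mono {D D' : ℤ → Set (R × List O)} (h : ∀ l, D l ⊆ D' l) {f : Fact R O}
    (hs : Derives π D f) : Derives π D' f := by
  obtain ⟨g, hg, r, hr, ν, h1, h2, h3, h4⟩ := hs
  exact ⟨g, hg.lift id fun _ _ => Step.mono h, r, hr, ν, h1, h2, h3.mono h, h4⟩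

/-- The transfer principle behind all replacement arguments. A path over `F` alternates between
steps of kind `V`, which `Θ` simulates one by one, and stretches of other steps, which are only
required to be simulated as a whole, between points in the domain of `Θ`. -/
theorem transfer_path {F F' : Type*} {StV StA : F → F → Prop} {InV InA : F → Prop}
    {St' : F' → F' → Prop} {In' : F' → Prop} (Θ : F → F' → Prop)
    (hV : ∀ f g f', StV f g → Θ f f' → ∃ g', Θ g g' ∧ St' f' g')
    (hdom : ∀ f g, StV f g → ∃ f', Θ f f')
    (hInV : ∀ f f', InV f → Θ f f' → In' f')
    (hInVdom : ∀ f, InV f → ∃ f', Θ f f')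
    (hA : ∀ f g f' g', Relation.TransGen StA f g → Θ f f' → Θ g g' →
      Relation.ReflTransGen St' f' g')
    (hInA : ∀ f g f', Relation.ReflTransGen StA f g → InA g → Θ f f' →
      ∃ g', Relation.ReflTransGen St' f' g' ∧ In' g')
    (hfun : ∀ f f' f'', Θ f f' → Θ f f'' → f' = f'')
    {f : F} {f' : F'} (hf : Θ f f') {g : F}
    (hg : Relation.ReflTransGen (fun a b => StV a b ∨ StA a b) f g) (hi : InV g ∨ InA g) :
    ∃ g', Relation.ReflTransGen St' f' g' ∧ In' g' := by
  -- The stretch of `A`-steps before `b` is carried along until the next `V`-step.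
  have key : ∀ b, Relation.ReflTransGen (fun a b => StV a b ∨ StA a b) b g →
      ∀ a a', Θ a a' → Relation.ReflTransGen StA a b →
        ∃ g', Relation.ReflTransGen St' a' g' ∧ In' g' := by
    have join : ∀ a b a' b', Relation.ReflTransGen StA a b → Θ a a' → Θ b b' →
        Relation.ReflTransGen St' a' b' := by
      intro a b a' b' hab ha hb
      rcases Relation.reflTransGen_iff_eq_or_transGen.1 hab with rfl | hab
      · rw [hfun _ _ _ ha hb]
      · exact hA _ _ _ _ hab ha hb
    intro b hb
    induction hb using Relation.ReflTransGen.head_induction_on with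
    | refl =>
      intro a a' ha hab
      rcases hi with hi | hi
      · obtain ⟨g', hg'⟩ := hInVdom _ hi
        exact ⟨g', join _ _ _ _ hab ha hg', hInV _ _ hi hg'⟩
      · exact hInA _ _ _ hab hi ha
    | @head b c hbc _ ih =>
      intro a a' ha hab
      rcases hbc with hbc | hbc
      · obtain ⟨b', hb'⟩ := hdom _ _ hbc
        obtain ⟨c', hc', hs⟩ := hV _ _ _ hbc hb'
        obtain ⟨g', hg', hi'⟩ := ih c c' hc' .refl
        exact ⟨g', (join _ _ _ _ hab ha hb').trans (.head hs hg'), hi'⟩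
      · exact ih a a' ha (hab.tail hbc)
  exact key f hg f f' hf .refl

end TDatalog

/-! ### Databases composed of placed bodies -/

namespace TDatalog

variable {R : Type*}

/-- A placed body `(n, t, B)`: a copy of the body `B` that is attached at the `n`-th node of a
description, at the moment `t`. -/
abbrev Placed (R : Type*) := ℤ × ℤ × Body R

/-- The objects of a database composed of placed bodies: the shared nodes and, for each placed
body, private copies of its variables. Nodes are integers, so that they can be translated. Unlike
in `wordDB`, two copies of a body at the same node and moment are not distinguished; this does not
affect derivability (`derives_wordDB_iff`). -/
inductive PObj (R : Type*) where
  | node (n : ℤ) : PObj R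
  | loc (p : Placed R) (v : ℕ) : PObj R

/-- The index of the node at which an object is introduced. -/
def PObj.idx : PObj R → ℤ
  | .node n => n
  | .loc p _ => p.1

/-- Translation of placed bodies by `a` nodes and `b` moments. -/
def Placed.shift (a b : ℤ) (p : Placed R) : Placed R := (p.1 + a, p.2.1 + b, p.2.2)

/-- Translation of objects. -/
def PObj.shift (a b : ℤ) : PObj R → PObj R
  | .node n => .node (n + a)
  | .loc p v => .loc (p.shift a b) v

/-- Translation of objects paired with moments. -/
def mshift (a b : ℤ) (m : PObj R × ℤ) : PObj R × ℤ := (m.1.shift a b, m.2 + b)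

section

variable (π : Program R)

open Classical in
/-- The object that stands for the variable `v` of a placed body: the answer variable is the node
at which the body is attached, and the exit variable of a vertical body is the next node. (The
exit variable of any other body is its answer variable.) -/
noncomputable def ob (p : Placed R) (v : ℕ) : PObj R :=
  if v = p.2.2.ans then .node p.1
  else if v = p.2.2.exitVar π then .node (p.1 + 1)
  else .loc p v

/-- The slices of the database that consists of the EDB atoms of a set of placed bodies. -/
def placedDB (P : Set (Placed R)) (l : ℤ) : Set (R × List (PObj R)) :=
  {f | ∃ p ∈ P, ∃ a ∈ p.2.2.atoms, ¬ π.IsIDB a.rel ∧ l = p.2.1 + a.shift ∧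
    f = (a.rel, a.args.map (ob π p))}

end

variable {π : Program R}

theorem ob_shift (a b : ℤ) (p : Placed R) (v : ℕ) : ob π (p.shift a b) v = (ob π p v).shift a b := by
  unfold ob Placed.shift
  simp only
  split_ifs
  · rfl
  · simp [PObj.shift, add_right_comm]
  · rfl

theorem ob_idx (p : Placed R) (v : ℕ) : (ob π p v).idx = p.1 ∨ (ob π p v).idx = p.1 + 1 := by
  unfold ob
  split_ifs <;> simp [PObj.idx]

theorem ob_eq_loc {p q : Placed R} {v w : ℕ} (h : ob π p v = .loc q w) : p = q ∧ v = w := by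
  unfold ob at h
  split_ifs at h
  simpa using h

theorem placedDB_mono {P P' : Set (Placed R)} (h : P ⊆ P') (l : ℤ) :
    placedDB π P l ⊆ placedDB π P' l := by
  rintro f ⟨p, hp, h'⟩
  exact ⟨p, h hp, h'⟩

theorem Derives.shift {P : Set (Placed R)} (a b : ℤ) {S : R} {m : PObj R × ℤ}
    (h : Derives π (placedDB π P) (S, m)) :
    Derives π (placedDB π (Placed.shift a b '' P)) (S, mshift a b m) := by
  refine Derives.map (φ := PObj.shift a b) (b := b) ?_ h
  rintro l S ds ⟨p, hp, at', ha, hn, rfl, hf⟩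
  refine ⟨p.shift a b, ⟨p, hp, rfl⟩, at', ha, hn, ?_, ?_⟩
  · simp [Placed.shift, add_right_comm]
  · rw [Prod.mk.injEq] at hf
    rw [hf.1, hf.2, List.map_map]
    congr 2
    funext v
    exact (ob_shift a b p v).symm

/-- `K` bounds the shifts and the diameters of the bodies of `π`. -/
structure Bounds (π : Program R) (K : ℕ) : Prop where
  shift : ∀ r ∈ π, ∀ a ∈ r.body.atoms, |a.shift| ≤ K
  dist : ∀ r ∈ π, ∀ u v, r.body.gaifman.dist u v ≤ K

/-- The setting for the replacement of a set `A` of placed bodies by a set `A'`. The remaining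
bodies are grouped into sets `Q i`, one for each port `i`, and are translated by `a` nodes and by
`b i` moments to `Q' i`. The only object that `A` shares with the `Q i` is the node `h`;
`priv i` contains the other objects of `Q i`, and `Z i` is the set of moments at which the node
`h` is assigned to `Q i`, with `W i` the part of `Z i` where bodies of `A` may interfere. -/
structure Replacement (π : Program R) (K : ℕ) (A A' : Set (Placed R)) (h a : ℤ) {ι : Type}
    (Q Q' : ι → Set (Placed R)) (priv : ι → Set (PObj R)) (Z W : ι → Set ℤ) (b : ι → ℤ) :
    Prop where
  bodies_A : ∀ p ∈ A, p.2.2 ∈ π.bodies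
  bodies_Q : ∀ i, ∀ p ∈ Q i, p.2.2 ∈ π.bodies
  ob_Q : ∀ i, ∀ p ∈ Q i, ∀ v ∈ p.2.2.vars, ob π p v ∈ priv i ∨
    (ob π p v = .node h ∧ ∀ l, |p.2.1 - l| ≤ 2 * K → l ∈ Z i)
  ob_A : ∀ i, ∀ p ∈ A, ∀ v ∈ p.2.2.vars, ob π p v ∉ priv i
  node_h : ∀ i, .node h ∉ priv i
  idx_A : ∀ p ∈ A, ∀ v ∈ p.2.2.vars, (ob π p v).idx ≤ h
  near_A : ∀ i, ∀ p ∈ A, ∀ v ∈ p.2.2.vars, ob π p v = .node h → ∀ l ∈ Z i,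
    |p.2.1 - l| ≤ 2 * K → l ∈ W i
  W_sub : ∀ i, W i ⊆ Z i
  boundary : ∀ i, ∀ l ∈ Z i, ∀ l' ∉ Z i, |l - l'| ≤ 2 * K → ∃ l'' ∈ W i, |l'' - l| ≤ 2 * K
  priv_disj : ∀ i j, i ≠ j → Disjoint (priv i) (priv j)
  Z_sep : ∀ i j, i ≠ j → ∀ l ∈ Z i, ∀ l' ∈ Z j, 2 * (K : ℤ) < |l - l'|
  map_Q : ∀ i, ∀ p ∈ Q i, p.shift a (b i) ∈ Q' i
  map_A : ∀ i, ∀ p ∈ A, h - K - 1 ≤ p.1 → p.1 ≤ h → (∃ l ∈ W i, |p.2.1 - l| ≤ 2 * K) →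
    p.shift a (b i) ∈ A'

section Replacement

variable {K : ℕ} {A A' : Set (Placed R)} {h a : ℤ} {ι : Type}
  {Q Q' : ι → Set (Placed R)} {priv : ι → Set (PObj R)} {Z W : ι → Set ℤ} {b : ι → ℤ}

/-- The part of the moment-objects that is assigned to the port `i`. -/
def VPart (h : ℤ) (priv : ι → Set (PObj R)) (Z : ι → Set ℤ) (i : ι) (m : PObj R × ℤ) : Prop :=
  m.1 ∈ priv i ∨ (m.1 = .node h ∧ m.2 ∈ Z i)

/-- The moment-objects of `A` that can be reached from the port `i` through `d` shared atoms. -/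
def Window (π : Program R) (K : ℕ) (A : Set (Placed R)) (h : ℤ) (W : ι → Set ℤ) (i : ι) (d : ℕ)
    (m : PObj R × ℤ) : Prop :=
  m.2 ∈ W i ∧ h - d ≤ m.1.idx ∧
    (m.1 = .node h ∨ ∃ p ∈ A, ∃ v ∈ p.2.2.vars, m.1 = ob π p v ∧ |p.2.1 - m.2| ≤ 2 * K)

/-- The moment-objects around the port `i` that are touched by a rule application that touches
`VPart h priv Z i`, including the target of its IDB atom. -/
def Near (π : Program R) (K : ℕ) (A : Set (Placed R)) (h : ℤ) (priv : ι → Set (PObj R))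
    (Z W : ι → Set ℤ) (i : ι) (m : PObj R × ℤ) : Prop :=
  ∃ k : ℤ, |k| ≤ K ∧
    (VPart h priv Z i (m.1, m.2 + k) ∨ Window π K A h W i K (m.1, m.2 + k))

/-- The finitely many moment-objects of `A` around the port `i` at which derivations may enter and
leave the remaining database. -/
def Named (K : ℕ) (A : Set (Placed R)) (h : ℤ) (W : ι → Set ℤ) (i : ι) (m : PObj R × ℤ) : Prop :=
  (∃ l ∈ W i, |l - m.2| ≤ 3 * K) ∧ h - K ≤ m.1.idx ∧ m.1.idx ≤ h ∧
    ∀ p v, m.1 = .loc p v → p ∈ A ∧ v ∈ p.2.2.vars ∧ |p.2.1 - m.2| ≤ 3 * K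

/-- Different ports do not interfere. -/
theorem Replacement.near_unique (H : Replacement π K A A' h a Q Q' priv Z W b)
    {i j : ι} {m : PObj R × ℤ}
    (hi : Near π K A h priv Z W i m) (hj : Near π K A h priv Z W j m) : i = j := by
  by_contra hij
  obtain ⟨o, l⟩ := m
  -- Away from private objects, `m` is within `K` moments of both `Z i` and `Z j`.
  have aux : ∀ i, Near π K A h priv Z W i (o, l) → (∀ j, o ∉ priv j) →
      ∃ k : ℤ, |k| ≤ K ∧ l + k ∈ Z i := by
    rintro i ⟨k, hk, (h1 | h1) | h1⟩ hp
    · exact absurd h1 (hp i)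
    · exact ⟨k, hk, h1.2⟩
    · exact ⟨k, hk, H.W_sub i h1.1⟩
  have aux2 : ∀ i j, i ≠ j → Near π K A h priv Z W i (o, l) → o ∉ priv j := by
    rintro i j hij ⟨k, hk, (h1 | h1) | ⟨-, -, h1 | ⟨p, hp, v, hv, h1, -⟩⟩⟩ hp'
    · exact Set.disjoint_left.1 (H.priv_disj i j hij) h1 hp'
    · exact H.node_h j (h1.1 ▸ hp')
    · exact H.node_h j (h1 ▸ hp')
    · exact H.ob_A j p hp v hv (h1 ▸ hp')
  by_cases hp : ∃ k, o ∈ priv k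
  · obtain ⟨k, hk⟩ := hp
    by_cases hik : i = k
    · exact aux2 j i (Ne.symm hij) hj (hik ▸ hk)
    · exact aux2 i k hik hi hk
  · push Not at hp
    obtain ⟨k, hk, h1⟩ := aux i hi hp
    obtain ⟨k', hk', h2⟩ := aux j hj hp
    have := H.Z_sep i j hij _ h1 _ h2
    rw [abs_le] at hk hk'
    rw [lt_abs] at this
    omega

/-- An atom of a placed body that touches the part of a port or a window around it extends the
window by one step, and the placed body is carried over by the translation for this port. -/
theorem Replacement.window_spread (H : Replacement π K A A' h a Q Q' priv Z W b)
    {i : ι} {d : ℕ} {o o' : PObj R} {l : ℤ}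
    (hm : VPart h priv Z i (o, l) ∨ Window π K A h W i d (o, l)) (hd : d ≤ K)
    {p : Placed R} (hp : p ∈ A ∪ ⋃ j, Q j) (hpl : |p.2.1 - l| ≤ 2 * K)
    {v v' : ℕ} (hv : v ∈ p.2.2.vars) (hv' : v' ∈ p.2.2.vars)
    (ho : o = ob π p v) (ho' : o' = ob π p v') :
    (VPart h priv Z i (o', l) ∨ Window π K A h W i (d + 1) (o', l)) ∧
      p.shift a (b i) ∈ A' ∪ ⋃ j, Q' j := by
  have near : ∀ {d}, d ≤ K → VPart h priv Z i (o, l) ∨ Window π K A h W i d (o, l) →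
      Near π K A h priv Z W i (o, l) := by
    rintro d hd (h1 | h1)
    · exact ⟨0, by simp, .inl (by simpa using h1)⟩
    · refine ⟨0, by simp, .inr ⟨by simpa using h1.1, ?_, by simpa using h1.2.2⟩⟩
      have h2 : h - d ≤ o.idx := h1.2.1
      change h - (K : ℤ) ≤ o.idx
      omega
  rcases hp with hp | hp
  · have idx' := H.idx_A p hp v' hv'
    have idxo := H.idx_A p hp v hv
    have h1 := ob_idx (π := π) p v
    have h2 := ob_idx (π := π) p v'
    subst ho ho'
    have hmain : l ∈ W i ∧ h - d ≤ (ob π p v).idx := by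
      rcases hm with (hm | hm) | hm
      · exact absurd hm (H.ob_A i p hp v hv)
      · refine ⟨H.near_A i p hp v hv hm.1 l hm.2 hpl, ?_⟩
        rw [show ob π p v = .node h from hm.1]
        simp [PObj.idx]
      · exact ⟨hm.1, hm.2.1⟩
    refine ⟨.inr ⟨hmain.1, ?_, .inr ⟨p, hp, v', hv', rfl, hpl⟩⟩, .inl ?_⟩
    · have := hmain.2
      change h - ((d + 1 : ℕ) : ℤ) ≤ (ob π p v').idx
      omega
    · have := hmain.2
      exact H.map_A i p hp (by omega) (by omega) ⟨l, hmain.1, hpl⟩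
  · obtain ⟨j, hp⟩ := Set.mem_iUnion.1 hp
    have hj : ∀ w ∈ p.2.2.vars, VPart h priv Z j (ob π p w, l) := by
      intro w hw
      rcases H.ob_Q j p hp w hw with h1 | h1
      · exact .inl h1
      · exact .inr ⟨h1.1, h1.2 l hpl⟩
    have hij : i = j := H.near_unique (near hd hm)
      ⟨0, by simp, .inl (by simpa [ho] using hj v hv)⟩
    subst hij
    exact ⟨.inl (ho' ▸ hj v' hv'), .inr (Set.mem_iUnion.2 ⟨i, H.map_Q i p hp⟩)⟩

/-- The placed body that provides an EDB atom of a rule body which holds at the moment `l` is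
attached within `2 * K` moments of `l`, as both shifts involved are at most `K`. -/
theorem Fires.exists_placed (hK : Bounds π K)
    {P : Set (Placed R)} (hP : ∀ p ∈ P, p.2.2 ∈ π.bodies) {r : Rule R} (hr : r ∈ π)
    {ν : ℕ → PObj R} {l : ℤ} (hf : Fires π (placedDB π P) r.body ν l) {c : Atom R}
    (hc : c ∈ r.body.atoms) (hn : ¬ π.IsIDB c.rel) :
    ∃ p ∈ P, |p.2.1 - l| ≤ 2 * K ∧ (∀ u ∈ c.args, ∃ v ∈ p.2.2.vars, ν u = ob π p v) ∧
      ∀ (P' : Set (Placed R)) (a b : ℤ), p.shift a b ∈ P' →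
        (c.rel, c.args.map (PObj.shift a b ∘ ν)) ∈ placedDB π P' (l + b + c.shift) := by
  obtain ⟨p, hp, c', hc', hn', hl, he⟩ := hf c hc hn
  rw [Prod.mk.injEq] at he
  obtain ⟨r', hr', hr'b⟩ := hP p hp
  have h1 := abs_le.1 (hK.shift r hr c hc)
  have h2 := abs_le.1 (hK.shift r' hr' c' (hr'b ▸ hc'))
  refine ⟨p, hp, abs_le.2 ⟨by omega, by omega⟩, ?_, ?_⟩
  · intro u hu
    have : ν u ∈ c'.args.map (ob π p) := he.2 ▸ List.mem_map_of_mem hu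
    obtain ⟨v, hv, hve⟩ := List.mem_map.1 this
    exact ⟨v, ⟨c', hc', hv⟩, hve.symm⟩
  · intro P' a b hp'
    refine ⟨_, hp', c', hc', hn', ?_, ?_⟩
    · simp only [Placed.shift]
      omega
    · rw [← List.map_map, he.2, he.1, List.map_map]
      congr 2
      funext v
      exact (ob_shift a b p v).symm

theorem Replacement.bodies_union (H : Replacement π K A A' h a Q Q' priv Z W b) :
    ∀ p ∈ A ∪ ⋃ j, Q j, p.2.2 ∈ π.bodies := by
  rintro p (hp | hp)
  · exact H.bodies_A p hp
  · obtain ⟨j, hp⟩ := Set.mem_iUnion.1 hp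
    exact H.bodies_Q j p hp

/-- Bodies are connected, so a rule application that touches the part of a port stays close to
it, and the translation for this port carries it over. -/
theorem Replacement.fires_shift (H : Replacement π K A A' h a Q Q' priv Z W b)
    {G : R} {ar : R → ℕ} (hq : IsQuery ar π G) (hK : Bounds π K)
    {r : Rule R} (hr : r ∈ π) {ν : ℕ → PObj R} {l : ℤ}
    (hf : Fires π (placedDB π (A ∪ ⋃ j, Q j)) r.body ν l) {i : ι} {x : ℕ}
    (hx : x ∈ r.body.vars) (hV : VPart h priv Z i (ν x, l)) :
    (∀ y ∈ r.body.vars,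
      VPart h priv Z i (ν y, l) ∨ Window π K A h W i K (ν y, l)) ∧
    Fires π (placedDB π (A' ∪ ⋃ j, Q' j)) r.body (PObj.shift a (b i) ∘ ν) (l + b i) := by
  have walk : ∀ (u v : {v // v ∈ r.body.vars}) (w : r.body.gaifman.Walk u v) (d : ℕ),
      (VPart h priv Z i (ν u, l) ∨ Window π K A h W i d (ν u, l)) → d + w.length ≤ K →
      (VPart h priv Z i (ν v, l) ∨ Window π K A h W i (d + w.length) (ν v, l)) := by
    intro u v w
    induction w with
    | nil => exact fun d hd _ => hd
    | cons hadj w ih =>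
      intro d hd hle
      rw [SimpleGraph.Walk.length_cons] at hle ⊢
      obtain ⟨hne, c, hc, hu, hv⟩ := hadj
      have hn : ¬ π.IsIDB c.rel := by
        intro hi
        cases ha : r.body.idbAtom π with
        | none => exact idbAtom_none ha hc hi
        | some c' =>
          obtain rfl := hq.idbAtom_unique hr ha hc hi
          rw [hq.args_eq hr ha, List.mem_singleton] at hu hv
          exact hne (Subtype.ext (hu.trans hv.symm))
      obtain ⟨p, hp, hpl, hob, -⟩ := hf.exists_placed hK H.bodies_union hr hc hn
      obtain ⟨x1, hx1, e1⟩ := hob _ hu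
      obtain ⟨x2, hx2, e2⟩ := hob _ hv
      have := ih (d + 1) (H.window_spread hd (by omega) hp hpl hx1 hx2 e1 e2).1 (by omega)
      rwa [add_assoc, add_comm 1] at this
  have weaken : ∀ m d, d ≤ K → Window π K A h W i d m → Window π K A h W i K m := by
    rintro m d hd ⟨h1, h2, h3⟩
    exact ⟨h1, by omega, h3⟩
  have all : ∀ y ∈ r.body.vars,
      VPart h priv Z i (ν y, l) ∨ Window π K A h W i K (ν y, l) := by
    intro y hy
    obtain ⟨w, hw⟩ := (hq.connected r hr).exists_walk_length_eq_dist ⟨x, hx⟩ ⟨y, hy⟩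
    have hd := hK.dist r hr ⟨x, hx⟩ ⟨y, hy⟩
    have := walk _ _ w 0 (.inl hV) (by omega)
    exact this.imp_right (weaken _ _ (by omega))
  refine ⟨all, fun c hc hn => ?_⟩
  obtain ⟨p, hp, hpl, hob, hsh⟩ := hf.exists_placed hK H.bodies_union hr hc hn
  obtain ⟨u, hu⟩ := hq.args_ne_nil hr hc
  obtain ⟨v, hv, e⟩ := hob u hu
  exact hsh _ _ _ (H.window_spread (all u ⟨c, hc, hu⟩) le_rfl hp hpl hv hv e e).2

/-- A rule application that does not touch the part of any port uses only atoms of `A`. -/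
theorem Replacement.fires_inner (H : Replacement π K A A' h a Q Q' priv Z W b)
    {G : R} {ar : R → ℕ} (hq : IsQuery ar π G) (hK : Bounds π K)
    {r : Rule R} (hr : r ∈ π) {ν : ℕ → PObj R} {l : ℤ}
    (hf : Fires π (placedDB π (A ∪ ⋃ j, Q j)) r.body ν l)
    (hV : ∀ x ∈ r.body.vars, ∀ i, ¬ VPart h priv Z i (ν x, l)) :
    Fires π (placedDB π A) r.body ν l := by
  intro c hc hn
  obtain ⟨p, hp, c', hc', hn', hl, he⟩ := hf c hc hn
  rcases hp with hp | hp
  · exact ⟨p, hp, c', hc', hn', hl, he⟩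
  · exfalso
    obtain ⟨i, hp⟩ := Set.mem_iUnion.1 hp
    obtain ⟨r', hr', hr'b⟩ := H.bodies_Q i p hp
    have h1 := abs_le.1 (hK.shift r hr c hc)
    have h2 := abs_le.1 (hK.shift r' hr' c' (hr'b ▸ hc'))
    obtain ⟨u, hu⟩ := hq.args_ne_nil hr hc
    rw [Prod.mk.injEq] at he
    have : ν u ∈ c'.args.map (ob π p) := he.2 ▸ List.mem_map_of_mem hu
    obtain ⟨v, hv, hve⟩ := List.mem_map.1 this
    refine hV u ⟨c, hc, hu⟩ i ?_
    rcases H.ob_Q i p hp v ⟨c', hc', hv⟩ with h3 | h3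
    · exact .inl (hve ▸ h3)
    · exact .inr ⟨hve ▸ h3.1, h3.2 l (abs_le.2 ⟨by omega, by omega⟩)⟩

/-- A moment-object at which a path leaves or enters the part of a port is named, if it takes
part in a rule application that does not touch the part of any port. -/
theorem Replacement.named_of_near (H : Replacement π K A A' h a Q Q' priv Z W b)
    {i : ι} {o : PObj R} {l : ℤ}
    (hm : Near π K A h priv Z W i (o, l)) {k : ℤ} (hk : |k| ≤ K)
    (hV : ∀ j, ¬ VPart h priv Z j (o, l + k)) : Named K A h W i (o, l) := by
  obtain ⟨k', hk', hm⟩ := hm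
  rw [abs_le] at hk hk'
  rcases hm with (hm | ⟨hm, hZ⟩) | ⟨hW, hidx, hm⟩
  · exact absurd (.inl hm) (hV i)
  · obtain rfl : o = .node h := hm
    have hZ' : l + k ∉ Z i := fun hz => hV i (.inr ⟨rfl, hz⟩)
    obtain ⟨l'', hl'', hl⟩ := H.boundary i _ hZ _ hZ' (abs_le.2 ⟨by simp only; omega, by simp only; omega⟩)
    refine ⟨⟨l'', hl'', ?_⟩, ?_, le_rfl, ?_⟩
    · rw [abs_le] at hl ⊢
      simp only at hl ⊢
      omega
    · simp [PObj.idx]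
    · rintro p v ⟨⟩
  · simp only at hW hidx hm
    refine ⟨⟨l + k', hW, abs_le.2 ⟨by simp only; omega, by simp only; omega⟩⟩, hidx, ?_, ?_⟩
    · rcases hm with rfl | ⟨p, hp, v, hv, rfl, -⟩
      · exact le_rfl
      · exact H.idx_A p hp v hv
    · rintro q w rfl
      rcases hm with hm | ⟨p, hp, v, hv, e, hl⟩
      · cases hm
      · obtain ⟨rfl, rfl⟩ := ob_eq_loc e.symm
        refine ⟨hp, hv, ?_⟩
        rw [abs_le] at hl ⊢
        simp only at hl ⊢
        omega

/-- If derivations over `A` between named moment-objects, and from the distinguished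
moment-object `g`, can be carried over to `A'`, then so can derivations over the whole
database. -/
theorem Replacement.derives (H : Replacement π K A A' h a Q Q' priv Z W b)
    {G : R} {ar : R → ℕ} (hq : IsQuery ar π G) (hK : Bounds π K)
    {g g' : PObj R × ℤ} (hg : ∀ i, Near π K A h priv Z W i g → g' = mshift a (b i) g)
    (path : ∀ S m m' S₁ m₁ m₁',
      ((∃ i, Named K A h W i m ∧ m' = mshift a (b i) m) ∨ (m = g ∧ m' = g')) →
      ((∃ i, Named K A h W i m₁ ∧ m₁' = mshift a (b i) m₁) ∨ (m₁ = g ∧ m₁' = g')) →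
      π.IsIDB S → π.IsIDB S₁ →
      Relation.ReflTransGen (Step π (placedDB π A)) (S, m) (S₁, m₁) →
      Relation.ReflTransGen (Step π (placedDB π A')) (S, m') (S₁, m₁'))
    (init : ∀ S m m',
      ((∃ i, Named K A h W i m ∧ m' = mshift a (b i) m) ∨ (m = g ∧ m' = g')) → π.IsIDB S →
      Derives π (placedDB π A) (S, m) → Derives π (placedDB π A') (S, m'))
    {S : R} {m m' : PObj R × ℤ}
    (hm : (∃ i, Near π K A h priv Z W i m ∧ m' = mshift a (b i) m) ∨ (m = g ∧ m' = g'))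
    (hd : Derives π (placedDB π (A ∪ ⋃ i, Q i)) (S, m)) :
    Derives π (placedDB π (A' ∪ ⋃ i, Q' i)) (S, m') := by
  -- The rule applications that touch the part of some port are the ones to be copied.
  let T : Body R → (ℕ → PObj R) → ℤ → Prop :=
    fun B ν l => ∃ x ∈ B.vars, ∃ i, VPart h priv Z i (ν x, l)
  let D := placedDB π (A ∪ ⋃ i, Q i)
  let StX : (Prop → Prop) → Fact R (PObj R) → Fact R (PObj R) → Prop := fun c f g =>
    ∃ r ∈ π, ∃ ν : ℕ → PObj R, r.head = f.1 ∧ ν r.body.ans = f.2.1 ∧ Fires π D r.body ν f.2.2 ∧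
      c (T r.body ν f.2.2) ∧ ∃ a, r.body.idbAtom π = some a ∧ a.rel = g.1 ∧
        ν (r.body.exitVar π) = g.2.1 ∧ f.2.2 + a.shift = g.2.2
  let InX : (Prop → Prop) → Fact R (PObj R) → Prop := fun c f =>
    ∃ r ∈ π, ∃ ν : ℕ → PObj R, r.head = f.1 ∧ ν r.body.ans = f.2.1 ∧ Fires π D r.body ν f.2.2 ∧
      c (T r.body ν f.2.2) ∧ r.body.idbAtom π = none
  let Θ : Fact R (PObj R) → Fact R (PObj R) → Prop := fun f f' =>
    f'.1 = f.1 ∧ π.IsIDB f.1 ∧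
      ((∃ i, Near π K A h priv Z W i f.2 ∧ f'.2 = mshift a (b i) f.2) ∨ (f.2 = g ∧ f'.2 = g'))
  have near_fires : ∀ {r : Rule R}, r ∈ π → ∀ {ν : ℕ → PObj R} {l : ℤ}, Fires π D r.body ν l →
      T r.body ν l → ∃ i, (∀ y ∈ r.body.vars, ∀ k : ℤ, |k| ≤ K →
        Near π K A h priv Z W i (ν y, l + k)) ∧
        Fires π (placedDB π (A' ∪ ⋃ j, Q' j)) r.body (PObj.shift a (b i) ∘ ν) (l + b i) := by
    rintro r hr ν l hf ⟨x, hx, i, hV⟩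
    obtain ⟨h1, h2⟩ := H.fires_shift hq hK hr hf hx hV
    exact ⟨i, fun y hy k hk => ⟨-k, by simpa using hk, by simpa using h1 y hy⟩, h2⟩
  have near_fires' : ∀ {r : Rule R}, r ∈ π → ∀ {ν : ℕ → PObj R} {l : ℤ}, Fires π D r.body ν l →
      T r.body ν l → ∃ i, Near π K A h priv Z W i (ν r.body.ans, l) ∧
        (∀ a, r.body.idbAtom π = some a →
          Near π K A h priv Z W i (ν (r.body.exitVar π), l + a.shift)) ∧
        Fires π (placedDB π (A' ∪ ⋃ j, Q' j)) r.body (PObj.shift a (b i) ∘ ν) (l + b i) := by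
    intro r hr ν l hf hT
    obtain ⟨i, h1, h2⟩ := near_fires hr hf hT
    refine ⟨i, by simpa using h1 _ (hq.safe r hr) 0 (by simp), fun a ha => ?_, h2⟩
    exact h1 _ (hq.exitVar_mem hr) _ (hK.shift r hr a (idbAtom_some ha).1)
  have Θ_near : ∀ {f f' : Fact R (PObj R)} {i : ι}, Θ f f' → Near π K A h priv Z W i f.2 →
      f'.2 = mshift a (b i) f.2 := by
    rintro f f' i ⟨-, -, ⟨j, hj, e⟩ | ⟨e1, e2⟩⟩ hi
    · rw [e, H.near_unique hi hj]
    · rw [e2, e1]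
      exact hg i (e1 ▸ hi)
  have not_T : ∀ {f f' : Fact R (PObj R)} {ν : ℕ → PObj R} {B : Body R} {l k : ℤ} {x : ℕ},
      ¬ T B ν l → Θ f f' → x ∈ B.vars → ν x = f.2.1 → |k| ≤ K → l + k = f.2.2 →
      (∃ i, Named K A h W i f.2 ∧ f'.2 = mshift a (b i) f.2) ∨ (f.2 = g ∧ f'.2 = g') := by
    rintro f f' ν B l k x hT ⟨-, -, hΘ⟩ hx e hk e2
    refine hΘ.imp_left ?_
    rintro ⟨i, hi, e'⟩
    refine ⟨i, H.named_of_near (k := -k) hi (by simpa using hk) fun j hj => hT ⟨x, hx, j, ?_⟩, e'⟩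
    rw [e, show l = f.2.2 + -k by rw [← e2]; ring]
    exact hj
  have source : ∀ {f f' c : Fact R (PObj R)}, StX Not f c → Θ f f' →
      (∃ i, Named K A h W i f.2 ∧ f'.2 = mshift a (b i) f.2) ∨ (f.2 = g ∧ f'.2 = g') := by
    rintro f f' c ⟨r, hr, ν, -, h2, -, h4, -⟩ hΘ
    exact not_T h4 hΘ (hq.safe r hr) h2 (k := 0) (by simp) (by simp)
  have target : ∀ {f c c' : Fact R (PObj R)}, StX Not f c → Θ c c' →
      (∃ i, Named K A h W i c.2 ∧ c'.2 = mshift a (b i) c.2) ∨ (c.2 = g ∧ c'.2 = g') := by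
    rintro f c c' ⟨r, hr, ν, -, -, -, h4, d, h5, -, h6, h7⟩ hΘ
    exact not_T h4 hΘ (hq.exitVar_mem hr) h6 (hK.shift r hr d (idbAtom_some h5).1) h7
  have inner : ∀ {f g : Fact R (PObj R)}, StX Not f g → Step π (placedDB π A) f g := by
    rintro f g ⟨r, hr, ν, h1, h2, h3, h4, h5⟩
    refine ⟨r, hr, ν, h1, h2, H.fires_inner hq hK hr h3 ?_, h5⟩
    exact fun x hx i hV => h4 ⟨x, hx, i, hV⟩
  have outer : ∀ l, placedDB π A' l ⊆ placedDB π (A' ∪ ⋃ i, Q' i) l :=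
    placedDB_mono Set.subset_union_left
  obtain ⟨e, he, hi⟩ := hd
  have hS : π.IsIDB S := by
    rcases Relation.ReflTransGen.cases_head he with rfl | ⟨_, ⟨r, hr, _, h1, -⟩, -⟩
    · obtain ⟨r, hr, _, h1, -⟩ := hi
      exact ⟨r, hr, h1⟩
    · exact ⟨r, hr, h1⟩
  refine transfer_path (StV := StX id) (StA := StX Not) (InV := InX id) (InA := InX Not)
    (f := (S, m)) (f' := (S, m')) Θ ?_ ?_ ?_ ?_ ?_ ?_ ?_ ⟨rfl, hS, hm⟩ (g := e) ?_ ?_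
  · rintro f c f' ⟨r, hr, ν, h1, h2, h3, h4, d, h5, h6, h7, h8⟩ hΘ
    obtain ⟨i, n1, n2, n3⟩ := near_fires' hr h3 h4
    refine ⟨(c.1, mshift a (b i) c.2), ⟨rfl, h6 ▸ (idbAtom_some h5).2, .inl ⟨i, ?_, rfl⟩⟩, ?_⟩
    · have := n2 d h5
      rwa [h7, h8] at this
    · have e := Θ_near hΘ (i := i) (by rwa [h2] at n1)
      refine ⟨r, hr, PObj.shift a (b i) ∘ ν, h1.trans hΘ.1.symm, ?_, ?_, d, h5, h6, ?_, ?_⟩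
      · rw [e, Function.comp_apply, h2]; rfl
      · rw [e]; exact n3
      · rw [Function.comp_apply, h7]; rfl
      · rw [e]; simp only [mshift]; omega
  · rintro f c ⟨r, hr, ν, h1, h2, h3, h4, -⟩
    obtain ⟨i, n1, -, -⟩ := near_fires' hr h3 h4
    exact ⟨(f.1, mshift a (b i) f.2), rfl, ⟨r, hr, h1⟩, .inl ⟨i, by rwa [h2] at n1, rfl⟩⟩
  · rintro f f' ⟨r, hr, ν, h1, h2, h3, h4, h5⟩ hΘ
    obtain ⟨i, n1, -, n3⟩ := near_fires' hr h3 h4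
    have e := Θ_near hΘ (i := i) (by rwa [h2] at n1)
    refine ⟨r, hr, PObj.shift a (b i) ∘ ν, h1.trans hΘ.1.symm, ?_, ?_, h5⟩
    · rw [e, Function.comp_apply, h2]; rfl
    · rw [e]; exact n3
  · rintro f ⟨r, hr, ν, h1, h2, h3, h4, -⟩
    obtain ⟨i, n1, -, -⟩ := near_fires' hr h3 h4
    exact ⟨(f.1, mshift a (b i) f.2), rfl, ⟨r, hr, h1⟩, .inl ⟨i, by rwa [h2] at n1, rfl⟩⟩
  · intro f c f' c' hfc hf hc
    obtain ⟨_, hs, -⟩ := Relation.TransGen.head'_iff.1 hfc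
    obtain ⟨_, -, ht⟩ := Relation.TransGen.tail'_iff.1 hfc
    have := path f.1 f.2 f'.2 c.1 c.2 c'.2 (source hs hf) (target ht hc) hf.2.1 hc.2.1
      (hfc.to_reflTransGen.lift id fun _ _ => inner)
    have := this.lift id fun _ _ => Step.mono outer
    rwa [show f' = (f.1, f'.2) from Prod.ext hf.1 rfl, show c' = (c.1, c'.2) from Prod.ext hc.1 rfl]
  · rintro f c f' hfc ⟨r, hr, ν, h1, h2, h3, h4, h5⟩ hf
    have hn : (∃ i, Named K A h W i f.2 ∧ f'.2 = mshift a (b i) f.2) ∨ (f.2 = g ∧ f'.2 = g') := by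
      rcases Relation.ReflTransGen.cases_head hfc with rfl | ⟨_, hs, -⟩
      · exact not_T h4 hf (hq.safe r hr) h2 (k := 0) (by simp) (by simp)
      · exact source hs hf
    have := init f.1 f.2 f'.2 hn hf.2.1 ⟨c, hfc.lift id fun _ _ => inner, r, hr, ν, h1, h2,
      H.fires_inner hq hK hr h3 fun x hx i hV => h4 ⟨x, hx, i, hV⟩, h5⟩
    rw [show f' = (f.1, f'.2) from Prod.ext hf.1 rfl]
    exact this.mono outer
  · rintro f f' f'' hf' hf''
    refine Prod.ext (hf'.1.trans hf''.1.symm) ?_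
    rcases hf'.2.2 with ⟨i, hi, e⟩ | ⟨e1, e2⟩
    · rw [e, Θ_near hf'' hi]
    · rcases hf''.2.2 with ⟨i, hi, e⟩ | ⟨e3, e4⟩
      · rw [e, Θ_near hf' hi]
      · rw [e2, e4]
  · refine he.lift id fun f c hs => ?_
    obtain ⟨r, hr, ν, h1, h2, h3, h4⟩ := hs
    by_cases hT : T r.body ν f.2.2
    · exact .inl ⟨r, hr, ν, h1, h2, h3, hT, h4⟩
    · exact .inr ⟨r, hr, ν, h1, h2, h3, hT, h4⟩
  · obtain ⟨r, hr, ν, h1, h2, h3, h4⟩ := hi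
    by_cases hT : T r.body ν e.2.2
    · exact .inl ⟨r, hr, ν, h1, h2, h3, hT, h4⟩
    · exact .inr ⟨r, hr, ν, h1, h2, h3, hT, h4⟩

end Replacement

end TDatalog

/-! ### The finite invariant of a set of placed bodies -/

namespace TDatalog

variable {R : Type*}

/-- Moments relative to an anchor. Two close anchors are at most `8 * K` moments apart and windows
extend `3 * K` moments around them, names lie at most `3 * K` moments outside a window, and their
bodies are attached at most `3 * K` moments further away. -/
abbrev RelTime (K : ℕ) := ↥(Finset.Icc (-(20 * K : ℤ)) (20 * K))

/-- Node indices relative to the last node. -/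
abbrev RelNode (K : ℕ) := ↥(Finset.Icc (-(K + 1 : ℤ)) 0)

section

variable (π : Program R) (K : ℕ)

/-- The rule bodies of `π`. -/
abbrev BodyOf := {B : Body R // B ∈ π.bodies}

/-- The variables of the rule bodies of `π`. -/
abbrev VarOf := {v : ℕ // ∃ r ∈ π, v ∈ r.body.vars}

/-- The IDB relations of `π`. -/
abbrev IdbOf := {S : R // π.IsIDB S}

/-- Codes for moment-objects relative to a node and a moment: a node and a moment, and for an
object that is not a node moreover the moment, body and variable from which it stems. -/
abbrev Code := RelNode K × RelTime K × Option (RelTime K × BodyOf π × VarOf π)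

/-- Names of moment-objects: codes relative to one of two anchors, and a name `none` for a
distinguished moment-object. -/
abbrev Name := Option (Bool × Code π K)

/-- The values of the invariant `data`. -/
abbrev Data :=
  Set (Bool × RelNode K × RelTime K × BodyOf π) ×
    Set ((IdbOf π × Name π K) × (IdbOf π × Name π K)) ×
    Set (IdbOf π × Name π K) × Set (Name π K) × Set (RelTime K)

variable {π K}

/-- The moment-object with the given code, relative to node `0` and moment `0`. -/
def Code.decode : Code π K → PObj R × ℤ
  | (n, l, none) => (.node n, l)
  | (n, l, some (t, B, v)) => (.loc (n, t, B) v, l)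

/-- The anchors of names: the moments `T` and `P`. -/
def anchor (T P : ℤ) (i : Bool) : ℤ := if i then P else T

/-- The moment-object with the given name, relative to the node `h` and the anchors `T` and `P`,
where `g` is the distinguished one. -/
def Name.val (h T P : ℤ) (g : PObj R × ℤ) : Name π K → PObj R × ℤ
  | none => g
  | some (i, c) => mshift h (anchor T P i) c.decode

variable (π K) in
/-- The invariant: the placed bodies of `A` around the node `h` at the moments `T` and `P`, the
derivability relation of `A` between named moment-objects, the named moment-objects at which there
are complete derivations over `A`, the names of `g`, and the difference of `T` and `P` if it is
small. -/
def data (A : Set (Placed R)) (h T P : ℤ) (g : PObj R × ℤ) : Data π K :=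
  ({x | (h + x.2.1, anchor T P x.1 + x.2.2.1, x.2.2.2.1) ∈ A},
   {x | Relation.ReflTransGen (Step π (placedDB π A)) (x.1.1.1, x.1.2.val h T P g)
      (x.2.1.1, x.2.2.val h T P g)},
   {x | Derives π (placedDB π A) (x.1.1, x.2.val h T P g)},
   {x | x.val h T P g = g},
   {d | T = P + d})

end

variable {π : Program R} {K : ℕ}

theorem Placed.shift_shift (a b a' b' : ℤ) (p : Placed R) :
    (p.shift a b).shift a' b' = p.shift (a + a') (b + b') := by
  simp [Placed.shift, add_assoc]

theorem mshift_mshift (a b a' b' : ℤ) (m : PObj R × ℤ) :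
    mshift a' b' (mshift a b m) = mshift (a + a') (b + b') m := by
  obtain ⟨o | o, l⟩ := m <;> simp [mshift, PObj.shift, add_assoc, Placed.shift_shift]

theorem Placed.shift_zero (p : Placed R) : p.shift 0 0 = p := by simp [Placed.shift]

theorem mshift_zero (m : PObj R × ℤ) : mshift 0 0 m = m := by
  obtain ⟨o | o, l⟩ := m <;> simp [mshift, PObj.shift, Placed.shift_zero]

/-- The moment-object `m` has a code relative to `h` and `t`. -/
def Nameable (π : Program R) (K : ℕ) (h t : ℤ) (m : PObj R × ℤ) : Prop :=
  |m.2 - t| ≤ 15 * K ∧ h - K ≤ m.1.idx ∧ m.1.idx ≤ h ∧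
    ∀ p v, m.1 = .loc p v → p.2.2 ∈ π.bodies ∧ v ∈ p.2.2.vars ∧ |p.2.1 - m.2| ≤ 3 * K

theorem Nameable.exists_code {h t : ℤ} {m : PObj R × ℤ} (H : Nameable π K h t m) :
    ∃ c : Code π K, mshift h t c.decode = m := by
  obtain ⟨o, l⟩ := m
  obtain ⟨h1, h2, h3, h4⟩ := H
  simp only [abs_le] at h1
  simp only at h2 h3
  cases o with
  | node n =>
    simp only [PObj.idx] at h2 h3
    refine ⟨(⟨n - h, ?_⟩, ⟨l - t, ?_⟩, none), ?_⟩
    · rw [Finset.mem_Icc]; omega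
    · rw [Finset.mem_Icc]; omega
    · simp [Code.decode, mshift, PObj.shift]
  | loc p v =>
    obtain ⟨h5, h6, h7⟩ := h4 p v rfl
    simp only [abs_le] at h7
    simp only [PObj.idx] at h2 h3
    have hv : ∃ r ∈ π, v ∈ r.body.vars := by
      obtain ⟨r, hr, e⟩ := h5
      exact ⟨r, hr, e ▸ h6⟩
    refine ⟨(⟨p.1 - h, ?_⟩, ⟨l - t, ?_⟩, some (⟨p.2.1 - t, ?_⟩, ⟨p.2.2, h5⟩, ⟨v, hv⟩)), ?_⟩
    · rw [Finset.mem_Icc]; omega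
    · rw [Finset.mem_Icc]; omega
    · rw [Finset.mem_Icc]; omega
    · simp [Code.decode, mshift, PObj.shift, Placed.shift]

section Data

variable {A A' : Set (Placed R)} {h T P h' T' P' : ℤ} {g g' : PObj R × ℤ}

theorem data_box (H : data π K A h T P g = data π K A' h' T' P' g') (i : Bool) {p : Placed R}
    (hp : p ∈ A) (hB : p.2.2 ∈ π.bodies) (h1 : h - K - 1 ≤ p.1) (h2 : p.1 ≤ h)
    (h3 : |p.2.1 - anchor T P i| ≤ 20 * K) :
    p.shift (h' - h) (anchor T' P' i - anchor T P i) ∈ A' := by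
  rw [abs_le] at h3
  have hn : p.1 - h ∈ Finset.Icc (-(K + 1 : ℤ)) 0 := by rw [Finset.mem_Icc]; omega
  have ht : p.2.1 - anchor T P i ∈ Finset.Icc (-(20 * K : ℤ)) (20 * K) := by
    rw [Finset.mem_Icc]; omega
  have := (Set.ext_iff.1 (congrArg Prod.fst H) (i, ⟨_, hn⟩, ⟨_, ht⟩, ⟨p.2.2, hB⟩)).1
    (by simpa [data] using hp)
  simp only [data, Set.mem_ofPred_eq] at this
  convert this using 1
  simp only [Placed.shift, Prod.mk.injEq, and_true]
  constructor <;> ring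

theorem data_path (H : data π K A h T P g = data π K A' h' T' P' g') {S S' : R}
    (hS : π.IsIDB S) (hS' : π.IsIDB S') (x y : Name π K)
    (hr : Relation.ReflTransGen (Step π (placedDB π A)) (S, x.val h T P g)
      (S', y.val h T P g)) :
    Relation.ReflTransGen (Step π (placedDB π A')) (S, x.val h' T' P' g')
      (S', y.val h' T' P' g') :=
  (Set.ext_iff.1 (congrArg (fun d => d.2.1) H) ((⟨S, hS⟩, x), (⟨S', hS'⟩, y))).1 hr

theorem data_derives (H : data π K A h T P g = data π K A' h' T' P' g') {S : R}
    (hS : π.IsIDB S) (x : Name π K) (hr : Derives π (placedDB π A) (S, x.val h T P g)) :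
    Derives π (placedDB π A') (S, x.val h' T' P' g') :=
  (Set.ext_iff.1 (congrArg (fun d => d.2.2.1) H) (⟨S, hS⟩, x)).1 hr

theorem data_goal (H : data π K A h T P g = data π K A' h' T' P' g') (x : Name π K)
    (hx : x.val h T P g = g) : x.val h' T' P' g' = g' :=
  (Set.ext_iff.1 (congrArg (fun d => d.2.2.2.1) H) x).1 hx

theorem data_dist (H : data π K A h T P g = data π K A' h' T' P' g') (hd : |T - P| ≤ 20 * K) :
    T' - P' = T - P := by
  rw [abs_le] at hd
  have hm : T - P ∈ Finset.Icc (-(20 * K : ℤ)) (20 * K) := by rw [Finset.mem_Icc]; omega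
  have := (Set.ext_iff.1 (congrArg (fun d => d.2.2.2.2) H) ⟨_, hm⟩).1
    (show T = P + (T - P) by ring)
  have : T' = P' + (T - P) := this
  omega

theorem Nameable.exists_name {i : Bool} {m : PObj R × ℤ}
    (H : Nameable π K h (anchor T P i) m) (h' T' P' : ℤ) (g g' : PObj R × ℤ) :
    ∃ x : Name π K, x.val h T P g = m ∧
      x.val h' T' P' g' = mshift (h' - h) (anchor T' P' i - anchor T P i) m := by
  obtain ⟨c, hc⟩ := H.exists_code
  refine ⟨some (i, c), hc, ?_⟩
  rw [← hc, mshift_mshift]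
  simp [Name.val]

variable {ι : Type} {Q Q' : ι → Set (Placed R)} {priv : ι → Set (PObj R)} {Z W : ι → Set ℤ}

/-- Sets with equal invariants can replace each other, where the port `i` is attached at the
anchor `e i`. -/
theorem Replacement.derives_of_data {G : R} {ar : R → ℕ} (hq : IsQuery ar π G)
    (hK : Bounds π K) (H : data π K A h T P g = data π K A' h' T' P' g') (e : ι → Bool)
    (HR : Replacement π K A A' h (h' - h) Q Q' priv Z W
      fun i => anchor T' P' (e i) - anchor T P (e i))
    (hW : ∀ i, ∀ l ∈ W i, |l - anchor T P (e i)| ≤ 12 * K)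
    (hg : ∀ i, Near π K A h priv Z W i g → Nameable π K h (anchor T P (e i)) g)
    {S : R} {m m' : PObj R × ℤ}
    (hm : (∃ i, Near π K A h priv Z W i m ∧
      m' = mshift (h' - h) (anchor T' P' (e i) - anchor T P (e i)) m) ∨ (m = g ∧ m' = g'))
    (hd : Derives π (placedDB π (A ∪ ⋃ i, Q i)) (S, m)) :
    Derives π (placedDB π (A' ∪ ⋃ i, Q' i)) (S, m') := by
  have name : ∀ m m' : PObj R × ℤ, ((∃ i, Named K A h W i m ∧
      m' = mshift (h' - h) (anchor T' P' (e i) - anchor T P (e i)) m) ∨ (m = g ∧ m' = g')) →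
      ∃ x : Name π K, x.val h T P g = m ∧ x.val h' T' P' g' = m' := by
    rintro m m' (⟨i, ⟨⟨l, hl, h1⟩, h2, h3, h4⟩, rfl⟩ | ⟨rfl, rfl⟩)
    · refine Nameable.exists_name ⟨?_, h2, h3, fun p v hpv => ?_⟩ h' T' P' g g'
      · have := hW i l hl
        rw [abs_le] at this h1 ⊢
        omega
      · obtain ⟨h5, h6⟩ := h4 p v hpv
        exact ⟨HR.bodies_A p h5, h6⟩
    · exact ⟨none, rfl, rfl⟩
  refine HR.derives hq hK ?_ ?_ ?_ hm hd
  · intro i hi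
    obtain ⟨x, hx, hx'⟩ := (hg i hi).exists_name h' T' P' g g'
    rw [← hx', data_goal H x hx]
  · intro S m m' S₁ m₁ m₁' hm hm₁ hS hS₁ hr
    obtain ⟨x, rfl, rfl⟩ := name m m' hm
    obtain ⟨y, rfl, rfl⟩ := name m₁ m₁' hm₁
    exact data_path H hS hS₁ x y hr
  · intro S m m' hm hS hr
    obtain ⟨x, rfl, rfl⟩ := name m m' hm
    exact data_derives H hS x hr

/-- A set `A` of placed bodies is completed by sets `QT` and `QP` that share only the node `h`
with it. The set `QP` is attached at the moment `P`. The set `QT` occupies the half-line of the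
node `h` that begins about the moment `T` if `right` holds, and does not touch the node `h`
otherwise. The moment-object `g` is the one from which the derivation starts. -/
structure CutContext (π : Program R) (K : ℕ) (A : Set (Placed R)) (h T P : ℤ)
    (g : PObj R × ℤ) (right : Prop) (QT QP : Set (Placed R)) : Prop where
  bodies_A : ∀ p ∈ A, p.2.2 ∈ π.bodies
  bodies_T : ∀ p ∈ QT, p.2.2 ∈ π.bodies
  bodies_P : ∀ p ∈ QP, p.2.2 ∈ π.bodies
  idx_A : ∀ p ∈ A, ∀ v ∈ p.2.2.vars, (ob π p v).idx ≤ h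
  order : P ≤ T
  time_A : right → ∀ p ∈ A, ∀ v ∈ p.2.2.vars, ob π p v = .node h → p.2.1 ≤ T + K
  time_T : ∀ q ∈ QT, ∀ v ∈ q.2.2.vars, ob π q v = .node h → right ∧ T - K ≤ q.2.1
  time_P : ∀ q ∈ QP, ∀ v ∈ q.2.2.vars, ob π q v = .node h → q.2.1 = P
  meet_T : ∀ q ∈ QT, ∀ v ∈ q.2.2.vars, ∀ p ∈ A, ∀ w ∈ p.2.2.vars, ob π q v = ob π p w →
    ob π q v = .node h
  meet_P : ∀ q ∈ QP, ∀ v ∈ q.2.2.vars, ∀ p ∈ A, ∀ w ∈ p.2.2.vars, ob π q v = ob π p w →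
    ob π q v = .node h
  meet_TP : ∀ q ∈ QT, ∀ v ∈ q.2.2.vars, ∀ p ∈ QP, ∀ w ∈ p.2.2.vars, ob π q v = ob π p w →
    ob π q v = .node h
  goal_T : ∀ q ∈ QT, ∀ v ∈ q.2.2.vars, ob π q v = g.1 → g.1 = .node h
  goal_P : ∀ q ∈ QP, ∀ v ∈ q.2.2.vars, ob π q v = g.1 → g.1 = .node h
  goal_time : right → g.1 = .node h → g.2 ≤ T + 3 * K

/-- The invariant determines derivability in every context, both from the distinguished
moment-object and from those of the part `QT`, which move along with the anchor `T`. -/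
theorem CutContext.derives {G : R} {ar : R → ℕ} (hq : IsQuery ar π G)
    (hK : Bounds π K) (H : data π K A h T P g = data π K A' h' T' P' g') {right : Prop}
    {QT QP : Set (Placed R)} (C : CutContext π K A h T P g right QT QP) {S : R}
    {m m' : PObj R × ℤ}
    (hm : (m = g ∧ m' = g') ∨ (m' = mshift (h' - h) (T' - T) m ∧
      (m.1 = .node h → right ∧ T - 3 * K ≤ m.2) ∧
      (m.1 ≠ .node h → m.1 ≠ g.1 ∧ ∀ p ∈ A ∪ QP, ∀ v ∈ p.2.2.vars, ob π p v ≠ m.1)))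
    (hd : Derives π (placedDB π (A ∪ (QT ∪ QP))) (S, m)) :
    Derives π (placedDB π (A' ∪ (Placed.shift (h' - h) (T' - T) '' QT ∪
      Placed.shift (h' - h) (P' - P) '' QP))) (S, m') := by
  have hP := C.order
  have window : ∀ {ι : Type} {W : ι → Set ℤ} {i : ι} {t k : ℤ}, |k| ≤ K →
      (∀ l ∈ W i, |l - t| ≤ 12 * K) → Window π K A h W i K (g.1, g.2 + k) →
      Nameable π K h t g := by
    rintro ι W i t k hk hW ⟨h1, h2, h3⟩
    have h4 := hW _ h1
    simp only [abs_le] at h2 h3 h4 hk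
    refine ⟨by rw [abs_le]; omega, h2, ?_, ?_⟩
    · rcases h3 with h3 | ⟨p, hp, v, hv, h3, -⟩
      · exact h3 ▸ le_rfl
      · exact h3 ▸ C.idx_A p hp v hv
    · intro q w e
      rcases h3 with h3 | ⟨p, hp, v, hv, h3, h5⟩
      · rw [h3] at e; cases e
      · obtain ⟨rfl, rfl⟩ := ob_eq_loc (h3.symm.trans e)
        exact ⟨C.bodies_A p hp, hv, by rw [abs_le]; omega⟩
  have node : ∀ {t : ℤ}, g.1 = .node h → |g.2 - t| ≤ 15 * K → Nameable π K h t g := by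
    intro t e ht
    refine ⟨ht, ?_, ?_, ?_⟩
    · simp [e, PObj.idx]
    · simp [e, PObj.idx]
    · intro p v e'
      rw [e] at e'; cases e'
  by_cases hn : T - P ≤ 8 * K
  · -- The two zones are merged into one port, since they move by the same distance.
    have hTP : T' - P' = T - P := data_dist H (by rw [abs_le]; omega)
    let Z : Unit → Set ℤ := fun _ => {l | (right ∧ T - 3 * K ≤ l) ∨ |l - P| ≤ 3 * K}
    let W : Unit → Set ℤ := fun _ => {l | (right ∧ |l - T| ≤ 3 * K) ∨ |l - P| ≤ 3 * K}
    let priv : Unit → Set (PObj R) := fun _ =>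
      {o | o ≠ .node h ∧ o ≠ g.1 ∧ ∀ p ∈ A, ∀ v ∈ p.2.2.vars, ob π p v ≠ o}
    have hW : ∀ i, ∀ l ∈ W i, |l - anchor T P false| ≤ 12 * K := by
      rintro - l (⟨-, hl⟩ | hl) <;> rw [abs_le] at hl ⊢ <;> simp only [anchor] <;> grind
    have HR : Replacement π K A A' h (h' - h) (fun _ : Unit => QT ∪ QP)
        (fun _ => Placed.shift (h' - h) (T' - T) '' QT ∪ Placed.shift (h' - h) (P' - P) '' QP)
        priv Z W fun _ => anchor T' P' false - anchor T P false := by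
      refine
        { bodies_A := C.bodies_A
          bodies_Q := ?_
          ob_Q := ?_
          ob_A := fun _ p hp v hv h1 => h1.2.2 p hp v hv rfl
          node_h := fun _ h1 => h1.1 rfl
          idx_A := C.idx_A
          near_A := ?_
          W_sub := ?_
          boundary := ?_
          priv_disj := fun i j hij => absurd rfl hij
          Z_sep := fun i j hij => absurd rfl hij
          map_Q := ?_
          map_A := ?_ }
      · rintro - p (hp | hp)
        · exact C.bodies_T p hp
        · exact C.bodies_P p hp
      · rintro - q (hq | hq) v hv
        · by_cases e : ob π q v = .node h
          · obtain ⟨h1, h2⟩ := C.time_T q hq v hv e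
            refine .inr ⟨e, fun l hl => .inl ⟨h1, ?_⟩⟩
            rw [abs_le] at hl; omega
          · exact .inl ⟨e, fun h1 => e (h1.trans (C.goal_T q hq v hv h1)),
              fun p hp w hw h1 => e (C.meet_T q hq v hv p hp w hw h1.symm)⟩
        · by_cases e : ob π q v = .node h
          · have h2 := C.time_P q hq v hv e
            refine .inr ⟨e, fun l hl => .inr ?_⟩
            rw [abs_le] at hl ⊢; omega
          · exact .inl ⟨e, fun h1 => e (h1.trans (C.goal_P q hq v hv h1)),
              fun p hp w hw h1 => e (C.meet_P q hq v hv p hp w hw h1.symm)⟩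
      · rintro - p hp v hv e l (⟨h1, h2⟩ | h1) hl
        · have := C.time_A h1 p hp v hv e
          refine .inl ⟨h1, ?_⟩
          rw [abs_le] at hl ⊢; omega
        · exact .inr h1
      · rintro - l (⟨h1, h2⟩ | h1)
        · rw [abs_le] at h2
          exact .inl ⟨h1, by omega⟩
        · exact .inr h1
      · rintro i l hl l' hl' hll
        refine ⟨l, ?_, by simp⟩
        rcases hl with ⟨h1, h2⟩ | h1
        · have : ¬ T - 3 * K ≤ l' := fun h3 => hl' (.inl ⟨h1, h3⟩)
          refine .inl ⟨h1, ?_⟩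
          rw [abs_le] at hll ⊢; omega
        · exact .inr h1
      · rintro - q (hq | hq)
        · exact .inl ⟨q, hq, rfl⟩
        · refine .inr ⟨q, hq, ?_⟩
          rw [show P' - P = T' - T by omega]; rfl
      · rintro i p hp h1 h2 ⟨l, hl, h3⟩
        refine data_box H false hp (C.bodies_A p hp) h1 h2 ?_
        have := hW i l hl
        rw [abs_le] at h3 this ⊢
        omega
    have := HR.derives_of_data hq hK H (fun _ => false) hW ?_ (S := S) (m := m) (m' := m') ?_
    · simpa only [Set.iUnion_const] using this (by simpa only [Set.iUnion_const] using hd)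
    · rintro i ⟨k, hk, (h1 | ⟨h1, h2⟩) | h1⟩
      · exact absurd rfl h1.2.1
      · refine node h1 ?_
        change (right ∧ T - 3 * K ≤ g.2 + k) ∨ |g.2 + k - P| ≤ 3 * K at h2
        change |g.2 - T| ≤ _
        rw [abs_le] at hk ⊢
        rcases h2 with ⟨h2, h3⟩ | h2
        · have := C.goal_time h2 h1
          omega
        · rw [abs_le] at h2
          omega
      · exact window hk (hW i) h1
    · refine hm.symm.imp_left ?_
      rintro ⟨rfl, h1, h2⟩
      refine ⟨(), ⟨0, by simp, .inl ?_⟩, rfl⟩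
      rw [add_zero]
      by_cases e : m.1 = .node h
      · exact .inr ⟨e, .inl (h1 e)⟩
      · exact .inl ⟨e, (h2 e).1, fun p hp => (h2 e).2 p (.inl hp)⟩
  · -- The two zones are far apart and become separate ports: `true` for `QP`, `false` for `QT`.
    let Z : Bool → Set ℤ := fun i => {l | if i then |l - P| ≤ 3 * K else right ∧ T - 3 * K ≤ l}
    let W : Bool → Set ℤ := fun i => {l | if i then |l - P| ≤ 3 * K else right ∧ |l - T| ≤ 3 * K}
    let priv : Bool → Set (PObj R) := fun i =>
      {o | o ≠ .node h ∧ if i then ∃ q ∈ QP, ∃ v ∈ q.2.2.vars, ob π q v = o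
        else o ≠ g.1 ∧ ∀ p ∈ A ∪ QP, ∀ v ∈ p.2.2.vars, ob π p v ≠ o}
    have hW : ∀ i, ∀ l ∈ W i, |l - anchor T P i| ≤ 12 * K := by
      rintro (_ | _) l hl
      · have : |l - T| ≤ 3 * K := by simpa using And.right hl
        rw [abs_le] at this ⊢
        simp only [anchor]
        grind
      · have : |l - P| ≤ 3 * K := by simpa [W] using hl
        rw [abs_le] at this ⊢
        simp only [anchor]
        grind
    have HR : Replacement π K A A' h (h' - h) (fun i : Bool => cond i QP QT)
        (fun i => cond i (Placed.shift (h' - h) (P' - P) '' QP)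
          (Placed.shift (h' - h) (T' - T) '' QT))
        priv Z W fun i => anchor T' P' i - anchor T P i := by
      refine
        { bodies_A := C.bodies_A
          bodies_Q := ?_
          ob_Q := ?_
          ob_A := ?_
          node_h := fun _ h1 => h1.1 rfl
          idx_A := C.idx_A
          near_A := ?_
          W_sub := ?_
          boundary := ?_
          priv_disj := ?_
          Z_sep := ?_
          map_Q := ?_
          map_A := ?_ }
      · rintro (_ | _) p hp
        · exact C.bodies_T p hp
        · exact C.bodies_P p hp
      · rintro (_ | _) q hq v hv
        · by_cases e : ob π q v = .node h
          · obtain ⟨h1, h2⟩ := C.time_T q hq v hv e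
            refine .inr ⟨e, fun l hl => show right ∧ _ from ⟨h1, ?_⟩⟩
            rw [abs_le] at hl; omega
          · refine .inl ⟨e, fun h1 => e (h1.trans (C.goal_T q hq v hv h1)), ?_⟩
            rintro p (hp | hp) w hw h1
            · exact e (C.meet_T q hq v hv p hp w hw h1.symm)
            · exact e (C.meet_TP q hq v hv p hp w hw h1.symm)
        · by_cases e : ob π q v = .node h
          · have h2 := C.time_P q hq v hv e
            refine .inr ⟨e, fun l hl => show |l - P| ≤ _ from ?_⟩
            rw [abs_le] at hl ⊢; omega
          · exact .inl ⟨e, q, hq, v, hv, rfl⟩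
      · rintro (_ | _) p hp v hv h1
        · exact h1.2.2 p (.inl hp) v hv rfl
        · obtain ⟨h2, q, hq, w, hw, h3⟩ := h1
          exact h2 (h3 ▸ C.meet_P q hq w hw p hp v hv h3)
      · rintro (_ | _) p hp v hv e l hl hpl
        · have h1 : right ∧ T - 3 * K ≤ l := hl
          have := C.time_A h1.1 p hp v hv e
          refine show right ∧ |l - T| ≤ 3 * K from ⟨h1.1, ?_⟩
          rw [abs_le] at hpl ⊢; omega
        · exact hl
      · rintro (_ | _) l hl
        · have h1 : right ∧ |l - T| ≤ 3 * K := hl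
          rw [abs_le] at h1
          exact show right ∧ _ from ⟨h1.1, by omega⟩
        · exact hl
      · rintro (_ | _) l hl l' hl' hll
        · have h1 : right ∧ T - 3 * K ≤ l := hl
          have : ¬ T - 3 * K ≤ l' := fun h3 => hl' (show right ∧ _ from ⟨h1.1, h3⟩)
          refine ⟨l, show right ∧ |l - T| ≤ 3 * K from ⟨h1.1, ?_⟩, by simp⟩
          rw [abs_le] at hll ⊢; omega
        · exact ⟨l, hl, by simp⟩
      · have : Disjoint (priv false) (priv true) := by
          rw [Set.disjoint_left]
          rintro o h1 ⟨-, q, hq, w, hw, h3⟩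
          exact h1.2.2 q (.inr hq) w hw h3
        rintro (_ | _) (_ | _) hij
        · exact absurd rfl hij
        · exact this
        · exact this.symm
        · exact absurd rfl hij
      · have : ∀ l ∈ Z false, ∀ l' ∈ Z true, 2 * (K : ℤ) < l - l' := by
          intro l hl l' hl'
          have h1 : right ∧ T - 3 * K ≤ l := hl
          have h2 : |l' - P| ≤ 3 * K := hl'
          rw [abs_le] at h2
          omega
        rintro (_ | _) (_ | _) hij l hl l' hl'
        · exact absurd rfl hij
        · exact lt_abs.2 (.inl (this l hl l' hl'))
        · exact lt_abs.2 (.inr (by have := this l' hl' l hl; omega))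
        · exact absurd rfl hij
      · rintro (_ | _) q hq
        · exact ⟨q, hq, rfl⟩
        · exact ⟨q, hq, rfl⟩
      · rintro i p hp h1 h2 ⟨l, hl, h3⟩
        refine data_box H i hp (C.bodies_A p hp) h1 h2 ?_
        have := hW i l hl
        rw [abs_le] at h3 this ⊢
        omega
    have := HR.derives_of_data hq hK H id hW ?_ (S := S) (m := m) (m' := m') ?_
    · rw [← Set.union_eq_iUnion, ← Set.union_eq_iUnion] at this
      rw [Set.union_comm QT] at hd
      rw [Set.union_comm (_ '' QT)]
      exact this hd
    · rintro i ⟨k, hk, (h1 | ⟨h1, h2⟩) | h1⟩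
      · exfalso
        cases i
        · exact h1.2.1 rfl
        · obtain ⟨h2, q, hq, w, hw, h3⟩ := h1
          exact h2 (C.goal_P q hq w hw h3)
      · refine node h1 ?_
        rw [abs_le] at hk ⊢
        cases i
        · have h3 : right ∧ T - 3 * K ≤ g.2 + k := h2
          have := C.goal_time h3.1 h1
          simp only [anchor, id]
          grind
        · have h3 : |g.2 + k - P| ≤ 3 * K := h2
          rw [abs_le] at h3
          simp only [anchor, id]
          grind
      · exact window hk (hW i) h1
    · refine hm.symm.imp_left ?_
      rintro ⟨rfl, h1, h2⟩
      refine ⟨false, ⟨0, by simp, .inl ?_⟩, rfl⟩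
      rw [add_zero]
      by_cases e : m.1 = .node h
      · exact .inr ⟨e, h1 e⟩
      · exact .inl ⟨e, h2 e⟩

end Data

end TDatalog

/-! ### The placed bodies of a word -/

namespace TDatalog

variable {R : Type*} {π : Program R}

/-- The times of the letters of a word. -/
noncomputable def times (w : List (Omega π)) : List ℤ := letterTimes (segments w) 0

/-- The time at which a further segment would be attached to a word. -/
noncomputable def endTime (w : List (Omega π)) : ℤ := ((segments w).map exitOffset).sum

/-- The set of all placed bodies of a word. -/
def placedOf (w : List (Omega π)) : Set (Placed R) :=
  {p | ∃ i, Occurs w i p.2.1 p.2.2 ∧ p.1 = height (w.take i)}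

section Accept

variable {ar : R → ℕ} {G : R}

theorem wordDB_objects (w : List (Omega π)) (l : ℤ) (S : R) (ds : List (Obj R))
    (h : (S, ds) ∈ (wordDB w).slice l) : ∀ d ∈ ds, d ∈ (wordDB w).dom := by
  intro d hd
  obtain ⟨i, t, B, ho, a, ha, -, -, he⟩ := h
  rw [Prod.mk.injEq] at he
  rw [he.2] at hd
  obtain ⟨v, hv, rfl⟩ := List.mem_map.1 hd
  exact .inr ⟨i, t, B, ho, v, ⟨a, ha, hv⟩, rfl⟩

/-- The database of a word and the one of its placed bodies are homomorphically equivalent. -/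
theorem derives_wordDB_iff (w : List (Omega π)) (S : R) :
    Derives π (wordDB w).slice (S, .node 0, 0) ↔
      Derives π (placedDB π (placedOf w)) (S, .node 0, 0) := by
  classical
  constructor
  · intro h
    let φ : Obj R → PObj R := fun o => match o with
      | .node n => .node n
      | .loc i B v => .loc (height (w.take i), ((times w)[i]?).getD 0, B) v
    refine Derives.map (φ := φ) (b := 0) ?_ h
    rintro l S ds ⟨i, t, B, ho, a, ha, hn, rfl, hf⟩
    refine ⟨(height (w.take i), t, B), ⟨i, ho, rfl⟩, a, ha, hn, by simp, ?_⟩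
    rw [Prod.mk.injEq] at hf
    rw [hf.1, hf.2, List.map_map]
    congr 2
    funext v
    have ht : (times w)[i]? = some t := ho.1
    simp only [Function.comp_apply, objOf, ob]
    split_ifs <;> simp [φ, ht]
  · intro h
    -- Any copy of a placed body serves as the image of its private objects.
    let ψ : PObj R → Obj R := fun o => match o with
      | .node n => .node n.toNat
      | .loc p v =>
        if h : ∃ i, Occurs w i p.2.1 p.2.2 ∧ p.1 = height (w.take i) then .loc h.choose p.2.2 v
        else .node 0
    refine Derives.map (φ := ψ) (b := 0) ?_ h
    rintro l S ds ⟨p, hp, a, ha, hn, rfl, hf⟩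
    have hs := Exists.choose_spec (show ∃ i, Occurs w i p.2.1 p.2.2 ∧ p.1 = height (w.take i) from hp)
    refine ⟨_, p.2.1, p.2.2, hs.1, a, ha, hn, by simp, ?_⟩
    rw [Prod.mk.injEq] at hf
    rw [hf.1, hf.2, List.map_map]
    congr 2
    funext v
    simp only [Function.comp_apply, objOf, ob]
    split_ifs
    · simp only [ψ]
      congr 1
      have := hs.2
      omega
    · simp only [ψ]
      congr 1
      have := hs.2
      omega
    · exact dif_pos hp

theorem IsQuery.mem_accept_iff (hq : IsQuery ar π G) (w : List (Omega π)) :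
    w ∈ Accept π G ↔ Correct w ∧ Derives π (placedDB π (placedOf w)) (G, .node 0, 0) := by
  rw [← derives_wordDB_iff, ← hq.certain_iff (wordDB_objects w) hq.goal]
  rfl

end Accept

/-! ### Words as sequences of vertical letters and horizontal segments -/

/-- The word is empty or begins with a vertical letter. -/
def StartsVert (w : List (Omega π)) : Prop := ∀ L ∈ w.head?, VertLetter L

/-- The word is empty or ends with a vertical letter. -/
def EndsVert (w : List (Omega π)) : Prop := ∀ L ∈ w.getLast?, VertLetter L

theorem segments_nil : segments ([] : List (Omega π)) = [] := rfl

theorem segments_horiz_append {σ w : List (Omega π)} (hσ : HorizSegment σ) (hne : σ ≠ [])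
    (hw : StartsVert w) : segments (σ ++ w) = σ :: segments w := by
  classical
  unfold segments
  rw [List.splitBy_append, List.splitBy_of_isChain hne]
  · rfl
  · refine List.Pairwise.isChain (List.pairwise_of_forall_mem_list ?_)
    intro a ha b hb
    simp [hσ a ha, hσ b hb]
  · intro x hx y hy
    have h1 := hσ x (List.mem_of_getLast? hx)
    have h2 := hw y hy
    simp [h1, h2]

theorem segments_vert_cons {a : Omega π} (ha : VertLetter a) (w : List (Omega π)) :
    segments (a :: w) = [a] :: segments w ∨
      ∃ β s, segments w = β :: s ∧ ¬ HorizSegment β ∧ segments (a :: w) = (a :: β) :: s := by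
  classical
  cases w with
  | nil => exact .inl rfl
  | cons c w =>
    by_cases hc : VertLetter c
    · right
      have hne : segments (c :: w) ≠ [] := List.splitBy_ne_nil.2 (by simp)
      obtain ⟨β, s, hs⟩ := List.exists_cons_of_ne_nil hne
      obtain ⟨h1, h2, h3, h4⟩ := List.splitBy_eq_iff.1 hs
      obtain ⟨d, β', rfl⟩ : ∃ d β', β = d :: β' :=
        List.exists_cons_of_ne_nil fun h => h2 (h ▸ List.mem_cons_self)
      obtain rfl : c = d := by simpa using (List.cons.inj h1).1
      refine ⟨_, s, hs, fun h => h c (by simp) hc, List.splitBy_eq_iff.2 ⟨?_, ?_, ?_, ?_⟩⟩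
      · rw [h1]; simp
      · simpa using h2
      · intro m hm
        rcases List.mem_cons.1 hm with rfl | hm
        · exact List.IsChain.cons_cons (by simp [ha, hc]) (h3 _ (by simp))
        · exact h3 m (by simp [hm])
      · cases s with
        | nil => simp
        | cons τ s =>
          rw [List.isChain_cons_cons] at h4 ⊢
          obtain ⟨⟨u, v, h5⟩, h6⟩ := h4
          exact ⟨⟨by simp, v, by simpa using h5⟩, h6⟩
    · left
      unfold segments
      rw [show a :: c :: w = [a] ++ (c :: w) from rfl, List.splitBy_append]
      · rfl
      · intro x hx y hy
        obtain rfl : a = x := by simpa using hx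
        obtain rfl : c = y := by simpa using hy
        simp [ha, hc]

theorem letterTimes_eq_map (s : List (List (Omega π))) (t : ℤ) :
    letterTimes s t = (letterTimes s 0).map (t + ·) := by
  induction s generalizing t with
  | nil => rfl
  | cons σ s ih =>
    rw [letterTimes, letterTimes, ih (t + _), ih (0 + _)]
    simp [Function.comp_def, add_assoc]

theorem letterTimes_cons (σ : List (Omega π)) (s : List (List (Omega π))) :
    letterTimes (σ :: s) 0 =
      (List.range σ.length).map (letterOffset σ) ++ (letterTimes s 0).map (exitOffset σ + ·) := by
  rw [letterTimes, letterTimes_eq_map]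
  simp

theorem not_horizSegment_cons {a : Omega π} (ha : VertLetter a) (σ : List (Omega π)) :
    ¬ HorizSegment (a :: σ) := fun h => h a (by simp) ha

theorem exitOffset_vert_cons {a : Omega π} (ha : VertLetter a) {σ : List (Omega π)}
    (hσ : ¬ HorizSegment σ) : exitOffset (a :: σ) = letterShift a + exitOffset σ := by
  simp [exitOffset, not_horizSegment_cons ha, hσ]

theorem exitOffset_vert {a : Omega π} (ha : VertLetter a) : exitOffset [a] = letterShift a := by
  simp [exitOffset, not_horizSegment_cons ha]

theorem times_vert_cons {a : Omega π} (ha : VertLetter a) (w : List (Omega π)) :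
    times (a :: w) = 0 :: (times w).map (letterShift a + ·) := by
  unfold times
  rcases segments_vert_cons ha w with h | ⟨β, s, h1, h2, h3⟩
  · rw [h, letterTimes_cons, exitOffset_vert ha]
    simp [letterOffset, not_horizSegment_cons ha]
  · rw [h1, h3, letterTimes_cons, letterTimes_cons, exitOffset_vert_cons ha h2]
    simp [List.range_succ_eq_map, letterOffset, not_horizSegment_cons ha, h2, Function.comp_def,
      add_assoc]

theorem endTime_vert_cons {a : Omega π} (ha : VertLetter a) (w : List (Omega π)) :
    endTime (a :: w) = letterShift a + endTime w := by
  unfold endTime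
  rcases segments_vert_cons ha w with h | ⟨β, s, h1, h2, h3⟩
  · rw [h, List.map_cons, List.sum_cons, exitOffset_vert ha]
  · rw [h1, h3]
    simp [exitOffset_vert_cons ha h2, add_assoc]

theorem times_horiz_append {σ w : List (Omega π)} (hσ : HorizSegment σ) (hne : σ ≠ [])
    (hw : StartsVert w) : times (σ ++ w) =
      (List.range σ.length).map (letterOffset σ) ++ (times w).map (exitOffset σ + ·) := by
  unfold times
  rw [segments_horiz_append hσ hne hw, letterTimes_cons]

theorem endTime_horiz_append {σ w : List (Omega π)} (hσ : HorizSegment σ) (hne : σ ≠ [])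
    (hw : StartsVert w) : endTime (σ ++ w) = exitOffset σ + endTime w := by
  unfold endTime
  rw [segments_horiz_append hσ hne hw]
  simp

open Classical in
/-- Words are built from vertical letters and horizontal segments. -/
theorem word_induction {motive : List (Omega π) → Prop} (nil : motive [])
    (vert : ∀ a w, VertLetter a → motive w → motive (a :: w))
    (horiz : ∀ σ w, HorizSegment σ → σ ≠ [] → StartsVert w → motive w → motive (σ ++ w))
    (w : List (Omega π)) : motive w := by
  induction hn : w.length using Nat.strong_induction_on generalizing w with
  | _ n ih =>
    cases w with
    | nil => exact nil
    | cons a w =>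
      by_cases ha : VertLetter a
      · exact vert a w ha (ih _ (by simp [← hn]) w rfl)
      · let q : Omega π → Bool := fun L => decide ¬ VertLetter L
        have hq : (a :: w).takeWhile q = a :: w.takeWhile q := by
          rw [List.takeWhile_cons_of_pos (by simp [q, ha])]
        have hq' : (a :: w).dropWhile q = w.dropWhile q := by
          rw [List.dropWhile_cons_of_pos (by simp [q, ha])]
        rw [← List.takeWhile_append_dropWhile (p := q) (l := a :: w)]
        refine horiz _ _ ?_ (by simp [hq]) ?_ (ih _ ?_ _ rfl)
        · intro L hL
          simpa [q] using List.mem_takeWhile_imp hL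
        · intro L hL
          have := List.head?_dropWhile_not q (a :: w)
          rw [hL] at this
          simpa [q] using this
        · rw [hq', ← hn]
          have := (List.dropWhile_sublist q (l := w)).length_le
          simp only [List.length_cons]
          omega

theorem StartsVert.append {x z : List (Omega π)} (hx : StartsVert x)
    (h : EndsVert x ∨ StartsVert z) (hne : x ≠ [] ∨ StartsVert z) : StartsVert (x ++ z) := by
  cases x with
  | nil => simpa using hne
  | cons a x => exact fun L hL => hx L (by simpa using hL)

theorem EndsVert.of_append {x z : List (Omega π)} (h : EndsVert (x ++ z)) : EndsVert z := by
  intro L hL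
  refine h L ?_
  rw [List.getLast?_append]
  simp_all

theorem EndsVert.ne_nil {σ x : List (Omega π)} (h : EndsVert (σ ++ x)) (hσ : HorizSegment σ)
    (hne : σ ≠ []) : x ≠ [] := by
  rintro rfl
  refine hσ (σ.getLast hne) (List.getLast_mem hne) (h _ ?_)
  simp [List.getLast?_eq_some_getLast hne]

theorem times_length (w : List (Omega π)) : (times w).length = w.length := by
  induction w using word_induction with
  | nil => rfl
  | vert a w ha ih => simp [times_vert_cons ha, ih]
  | horiz σ w hσ hne hw ih => simp [times_horiz_append hσ hne hw, ih]

theorem times_endTime_append (x z : List (Omega π)) (h : EndsVert x ∨ StartsVert z) :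
    times (x ++ z) = times x ++ (times z).map (endTime x + ·) ∧
      endTime (x ++ z) = endTime x + endTime z := by
  induction x using word_induction with
  | nil => simp [times, endTime, segments_nil, letterTimes]
  | vert a x ha ih =>
    have h' : EndsVert x ∨ StartsVert z := h.imp_left (EndsVert.of_append (x := [a]))
    obtain ⟨h1, h2⟩ := ih h'
    rw [List.cons_append, times_vert_cons ha, times_vert_cons ha, endTime_vert_cons ha,
      endTime_vert_cons ha, h1, h2]
    simp [Function.comp_def, add_assoc]
  | horiz σ x hσ hne hx ih =>
    have h' : EndsVert x ∨ StartsVert z := h.imp_left EndsVert.of_append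
    have hxz : StartsVert (x ++ z) := hx.append h' (h.imp_left fun h => h.ne_nil hσ hne)
    obtain ⟨h1, h2⟩ := ih h'
    rw [List.append_assoc, times_horiz_append hσ hne hx, times_horiz_append hσ hne hxz,
      endTime_horiz_append hσ hne hx, endTime_horiz_append hσ hne hxz, h1, h2]
    simp [Function.comp_def, add_assoc]

theorem height_append (x z : List (Omega π)) : height (x ++ z) = height x + height z := by
  simp [height, List.countP_append]

theorem placedOf_append {x z : List (Omega π)} (h : EndsVert x ∨ StartsVert z) :
    placedOf (x ++ z) = placedOf x ∪ Placed.shift (height x) (endTime x) '' placedOf z := by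
  have ht := (times_endTime_append x z h).1
  ext ⟨n, t, B⟩
  constructor
  · rintro ⟨i, ⟨h1, L, h2, h3⟩, h4⟩
    change (times (x ++ z))[i]? = some t at h1
    change n = _ at h4
    rcases lt_or_ge i x.length with hi | hi
    · left
      rw [ht, List.getElem?_append_left (by simpa [times_length] using hi)] at h1
      rw [List.getElem?_append_left hi] at h2
      rw [List.take_append_of_le_length hi.le] at h4
      exact ⟨i, ⟨h1, L, h2, h3⟩, h4⟩
    · right
      rw [ht, List.getElem?_append_right (by simpa [times_length] using hi), times_length,
        List.getElem?_map] at h1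
      rw [List.getElem?_append_right hi] at h2
      rw [List.take_append, List.take_of_length_le hi, height_append] at h4
      obtain ⟨t', ht', rfl⟩ := Option.map_eq_some_iff.1 h1
      refine ⟨(height (z.take (i - x.length)), t', B), ⟨_, ⟨ht', L, h2, h3⟩, rfl⟩, ?_⟩
      simp [Placed.shift, h4, add_comm]
  · rintro (⟨i, ⟨h1, L, h2, h3⟩, h4⟩ | ⟨⟨n', t', B'⟩, ⟨i, ⟨h1, L, h2, h3⟩, h4⟩, he⟩)
    · change (times x)[i]? = some t at h1
      have hi : i < x.length := (List.getElem?_eq_some_iff.1 h2).1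
      refine ⟨i, ⟨?_, L, ?_, h3⟩, ?_⟩
      · change (times (x ++ z))[i]? = some t
        rw [ht, List.getElem?_append_left (by simpa [times_length] using hi), h1]
      · rw [List.getElem?_append_left hi, h2]
      · rw [List.take_append_of_le_length hi.le]
        exact h4
    · change (times z)[i]? = some t' at h1
      simp only [Placed.shift, Prod.mk.injEq] at he
      obtain ⟨rfl, rfl, rfl⟩ := he
      refine ⟨x.length + i, ⟨?_, L, ?_, h3⟩, ?_⟩
      · change (times (x ++ z))[x.length + i]? = some (t' + endTime x)
        rw [ht, List.getElem?_append_right (by simp [times_length]), times_length]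
        simp [h1, add_comm]
      · rw [List.getElem?_append_right (by simp)]
        simpa using h2
      · rw [List.take_append, List.take_of_length_le (by omega), height_append]
        simp only at h4
        simp [h4, add_comm]

/-! ### Correct words -/

open Classical in
/-- The conditions on the markers in a sequence of segments. -/
def OkSegments : List (List (Omega π)) → Prop
  | [] => True
  | σ :: s => (HorizSegment σ → σ.countP (fun L => decide (Symb.bot ∈ L)) = 1 ∧
      (s ≠ [] → σ.countP (fun L => decide (Symb.top ∈ L)) = 1)) ∧ OkSegments s

theorem correct_iff (w : List (Omega π)) :
    Correct w ↔ (∀ L ∈ w, CorrectLetter L) ∧ OkSegments (segments w) := by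
  classical
  have key : ∀ S : List (List (Omega π)), OkSegments S ↔
      (∀ σ ∈ S, HorizSegment σ → σ.countP (fun L => decide (Symb.bot ∈ L)) = 1) ∧
      ∀ s σ τ s', S = s ++ σ :: τ :: s' → HorizSegment σ →
        σ.countP (fun L => decide (Symb.top ∈ L)) = 1 := by
    intro S
    induction S with
    | nil => simp [OkSegments]
    | cons σ S ih =>
      rw [OkSegments, ih]
      constructor
      · rintro ⟨h1, h2, h3⟩
        refine ⟨?_, ?_⟩
        · intro σ' hσ' hh
          rcases List.mem_cons.1 hσ' with rfl | hσ'
          · exact (h1 hh).1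
          · exact h2 σ' hσ' hh
        · rintro (_ | ⟨ρ, s⟩) σ' τ s' he hh
          · simp only [List.nil_append, List.cons.injEq] at he
            obtain ⟨rfl, rfl⟩ := he
            exact (h1 hh).2 (by simp)
          · simp only [List.cons_append, List.cons.injEq] at he
            exact h3 s σ' τ s' he.2 hh
      · rintro ⟨h1, h2⟩
        refine ⟨fun hh => ⟨h1 σ (by simp) hh, fun hS => ?_⟩, fun σ' hσ' => h1 σ' (by simp [hσ']),
          fun s σ' τ s' he => h2 (σ :: s) σ' τ s' (by simp [he])⟩
        obtain ⟨τ, s', rfl⟩ := List.exists_cons_of_ne_nil hS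
        exact h2 [] σ τ s' rfl hh
  rw [key]
  exact ⟨fun h => ⟨h.letters, h.bot, h.top⟩, fun h => ⟨h.1, h.2.1, h.2.2⟩⟩

theorem correct_vert_cons {a : Omega π} (ha : VertLetter a) (w : List (Omega π)) :
    Correct (a :: w) ↔ Correct w := by
  have hl : CorrectLetter a := .inl ha
  rw [correct_iff, correct_iff]
  rcases segments_vert_cons ha w with h | ⟨β, s, h1, h2, h3⟩
  · rw [h, OkSegments]
    simp [hl, not_horizSegment_cons ha]
  · rw [h1, h3, OkSegments, OkSegments]
    simp [hl, not_horizSegment_cons ha, h2]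

open Classical in
theorem correct_horiz_append {σ w : List (Omega π)} (hσ : HorizSegment σ) (hne : σ ≠ [])
    (hw : StartsVert w) : Correct (σ ++ w) ↔
      ((∀ L ∈ σ, CorrectLetter L) ∧ σ.countP (fun L => decide (Symb.bot ∈ L)) = 1 ∧
        (w ≠ [] → σ.countP (fun L => decide (Symb.top ∈ L)) = 1)) ∧ Correct w := by
  rw [correct_iff, correct_iff, segments_horiz_append hσ hne hw, OkSegments]
  have : segments w ≠ [] ↔ w ≠ [] := List.splitBy_ne_nil
  rw [this]
  simp only [List.mem_append, hσ, forall_const, or_imp, forall_and]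
  tauto

theorem correct_append {x : List (Omega π)} (hx : EndsVert x) (z : List (Omega π)) :
    Correct (x ++ z) ↔ Correct x ∧ Correct z := by
  induction x using word_induction with
  | nil =>
    have : Correct ([] : List (Omega π)) := by
      rw [correct_iff, segments_nil]; simp [OkSegments]
    simp [this]
  | vert a x ha ih =>
    rw [List.cons_append, correct_vert_cons ha, correct_vert_cons ha]
    exact ih (hx.of_append (x := [a]))
  | horiz σ x hσ hne hsx ih =>
    have hx' := hx.of_append
    have hn := hx.ne_nil hσ hne
    rw [List.append_assoc, correct_horiz_append hσ hne hsx,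
      correct_horiz_append hσ hne (hsx.append (.inl hx') (.inl hn)), ih hx']
    simp only [ne_eq, List.append_eq_nil_iff, hn, false_and]
    tauto

end TDatalog

/-! ### Geometry of the placed bodies of a word -/

namespace TDatalog

variable {R : Type*} {π : Program R} {K : ℕ}

theorem shift_image_image (a b a' b' : ℤ) (P : Set (Placed R)) :
    Placed.shift a' b' '' (Placed.shift a b '' P) = Placed.shift (a + a') (b + b') '' P := by
  rw [Set.image_image]
  simp only [Placed.shift_shift]

theorem shift_zero_image (P : Set (Placed R)) : Placed.shift 0 0 '' P = P := by
  simp [Placed.shift_zero]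

theorem mem_shift_image {a b : ℤ} {P : Set (Placed R)} {p : Placed R} :
    p ∈ Placed.shift a b '' P ↔ (p.1 - a, p.2.1 - b, p.2.2) ∈ P := by
  constructor
  · rintro ⟨q, hq, rfl⟩
    simpa [Placed.shift] using hq
  · intro h
    exact ⟨_, h, by simp [Placed.shift]⟩

theorem ob_eq_node {p : Placed R} {v : ℕ} {m : ℤ} (h : ob π p v = .node m) :
    m = p.1 ∨ (p.2.2.Vertical π ∧ m = p.1 + 1) := by
  unfold ob at h
  split_ifs at h with h1 h2
  · left; simpa using h.symm
  · right
    refine ⟨fun e => h1 (h2.trans e), ?_⟩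
    simpa using h.symm

/-- The bodies of the letters of a horizontal segment, with the first letter at the moment `0`. -/
def horizPlaced (σ : List (Omega π)) : Set (Placed R) :=
  {p | p.1 = 0 ∧ ∃ j : ℕ, p.2.1 = j ∧ ∃ L, σ[j]? = some L ∧
    ∃ hB : p.2.2 ∈ π.bodies, Symb.body ⟨p.2.2, hB⟩ ∈ L}

theorem horizPlaced_append (σ ρ : List (Omega π)) : horizPlaced (σ ++ ρ) =
    horizPlaced σ ∪ Placed.shift 0 σ.length '' horizPlaced ρ := by
  ext p
  rw [Set.mem_union, mem_shift_image]
  constructor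
  · rintro ⟨h1, j, h2, L, h3, h4⟩
    rcases lt_or_ge j σ.length with hj | hj
    · rw [List.getElem?_append_left hj] at h3
      exact .inl ⟨h1, j, h2, L, h3, h4⟩
    · rw [List.getElem?_append_right hj] at h3
      refine .inr ⟨by simpa using h1, j - σ.length, ?_, L, h3, h4⟩
      simp only
      omega
  · rintro (⟨h1, j, h2, L, h3, h4⟩ | ⟨h1, j, h2, L, h3, h4⟩)
    · have hj := (List.getElem?_eq_some_iff.1 h3).1
      exact ⟨h1, j, h2, L, by rwa [List.getElem?_append_left hj], h4⟩
    · refine ⟨by simpa using h1, σ.length + j, ?_, L, ?_, h4⟩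
      · simp only at h2
        push_cast
        omega
      · rw [List.getElem?_append_right (by simp)]
        simpa using h3

theorem mem_horizPlaced {σ : List (Omega π)} (hl : ∀ L ∈ σ, CorrectLetter L)
    (hσ : HorizSegment σ) {p : Placed R} (hp : p ∈ horizPlaced σ) :
    p.2.2 ∈ π.bodies ∧ p.1 = 0 ∧ 0 ≤ p.2.1 ∧ p.2.1 < σ.length ∧ ¬ p.2.2.Vertical π := by
  obtain ⟨h1, j, h2, L, h3, hB, h4⟩ := hp
  have hj := (List.getElem?_eq_some_iff.1 h3).1
  have hL := List.mem_of_getElem? h3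
  refine ⟨hB, h1, by omega, by omega, ?_⟩
  exact (hl L hL).resolve_left (hσ L hL) _ h4

theorem height_horiz {σ : List (Omega π)} (hσ : HorizSegment σ) : height σ = 0 := by
  classical
  unfold height
  rw [List.countP_eq_zero]
  intro L hL
  simpa using hσ L hL

theorem startsVert_nil : StartsVert ([] : List (Omega π)) := by simp [StartsVert]

theorem times_horiz {σ : List (Omega π)} (hσ : HorizSegment σ) :
    times σ = (List.range σ.length).map (letterOffset σ) := by
  by_cases hne : σ = []
  · subst hne; rfl
  · simpa [times, segments_nil, letterTimes] using times_horiz_append hσ hne startsVert_nil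

theorem endTime_horiz {σ : List (Omega π)} (hσ : HorizSegment σ) :
    endTime σ = markerIdx Symb.top σ - markerIdx Symb.bot σ := by
  by_cases hne : σ = []
  · subst hne; simp [endTime, segments_nil, markerIdx]
  · simpa [endTime, segments_nil, exitOffset, hσ] using endTime_horiz_append hσ hne startsVert_nil

theorem placedOf_horiz {σ : List (Omega π)} (hσ : HorizSegment σ) :
    placedOf σ = Placed.shift 0 (-(markerIdx Symb.bot σ : ℤ)) '' horizPlaced σ := by
  ext ⟨n, t, B⟩
  rw [mem_shift_image]
  have hh : ∀ i, height (σ.take i) = 0 := fun i =>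
    height_horiz fun L hL => hσ L (List.mem_of_mem_take hL)
  have ht : ∀ i t, (times σ)[i]? = some t ↔
      i < σ.length ∧ (i : ℤ) - markerIdx Symb.bot σ = t := by
    intro i t
    rw [times_horiz hσ, List.getElem?_map]
    by_cases hi : i < σ.length
    · simp [letterOffset, hσ, hi]
    · simp [hi]
  constructor
  · rintro ⟨i, ⟨h1, L, h2, h3⟩, h4⟩
    have h1 := ((ht i t).1 h1).2
    rw [hh] at h4
    refine ⟨by simpa using h4, i, ?_, L, h2, h3⟩
    simp only
    omega
  · rintro ⟨h1, j, h2, L, h3, h4⟩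
    have hj := (List.getElem?_eq_some_iff.1 h3).1
    refine ⟨j, ⟨(ht j t).2 ⟨hj, ?_⟩, L, h3, h4⟩, ?_⟩
    · simp only at h2
      omega
    · rw [hh]
      simpa using h1

theorem mem_placedOf {w : List (Omega π)} (hl : ∀ L ∈ w, CorrectLetter L) {p : Placed R}
    (hp : p ∈ placedOf w) : p.2.2 ∈ π.bodies ∧ 0 ≤ p.1 ∧ p.1 ≤ height w ∧
      (p.2.2.Vertical π → p.1 + 1 ≤ height w) := by
  classical
  obtain ⟨i, ⟨-, L, h2, hB, h3⟩, h4⟩ := hp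
  have hle : ∀ j, height (w.take j) ≤ height w := fun j => (List.take_sublist j w).countP_le
  refine ⟨hB, by omega, by have := hle i; omega, fun hv => ?_⟩
  have hL : VertLetter L := by
    rcases hl L (List.mem_of_getElem? h2) with h | h
    · exact h
    · exact absurd hv (h _ h3)
  have : height (w.take (i + 1)) = height (w.take i) + 1 := by
    rw [List.take_add_one, h2, height_append]
    simp [height, hL]
  have := hle (i + 1)
  omega

theorem VertLetter.exists_body {a : Omega π} (ha : VertLetter a) : ∃ B ∈ π.bodies,
    B.Vertical π ∧ letterShift a = B.exitShift π ∧ placedOf [a] = {(0, 0, B)} := by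
  classical
  have hs := ha.choose_spec
  refine ⟨ha.choose.1, ha.choose.2, hs.1, by simp [letterShift, ha], ?_⟩
  have ht : times [a] = [0] := by
    rw [times_vert_cons ha]; rfl
  ext ⟨n, t, B⟩
  constructor
  · rintro ⟨i, ⟨h1, L, h2, hB, h3⟩, h4⟩
    change (times [a])[i]? = some t at h1
    rw [ht] at h1
    have hi := (List.getElem?_eq_some_iff.1 h2).1
    obtain rfl : i = 0 := by simpa using hi
    simp only [List.getElem?_cons_zero, Option.some.injEq] at h1 h2
    subst h1 h2
    rw [hs.2] at h3
    have : (⟨B, hB⟩ : {B : Body R // B ∈ π.bodies}) = ha.choose := by simpa using h3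
    have h4' : n = 0 := by simpa [height] using h4
    simp only [Set.mem_singleton_iff, Prod.mk.injEq, true_and, h4']
    exact congrArg Subtype.val this
  · rintro h
    simp only [Set.mem_singleton_iff, Prod.mk.injEq] at h
    obtain ⟨rfl, rfl, rfl⟩ := h
    refine ⟨0, ⟨?_, a, rfl, ha.choose.2, ?_⟩, by simp [height]⟩
    · change (times [a])[0]? = some 0
      rw [ht]; rfl
    · simp only [Subtype.coe_eta]
      have h5 : Symb.body ha.choose ∈ ({Symb.body ha.choose} : Set (Symb π)) := rfl
      rwa [← hs.2] at h5

theorem endTime_vert {a : Omega π} (ha : VertLetter a) : endTime [a] = letterShift a := by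
  rw [endTime_vert_cons ha]; simp [endTime, segments_nil]

theorem abs_letterShift_le (hK : Bounds π K) {a : Omega π} (ha : VertLetter a) :
    |letterShift a| ≤ K := by
  obtain ⟨B, ⟨r, hr, rfl⟩, -, hs, -⟩ := ha.exists_body
  rw [hs, Body.exitShift]
  cases h : r.body.idbAtom π with
  | none => simp
  | some c => simpa using hK.shift r hr c (idbAtom_some h).1

theorem height_vert {a : Omega π} (ha : VertLetter a) : height [a] = 1 := by
  simp [height, ha]

theorem EndsVert.eq_nil_or {x : List (Omega π)} (hx : EndsVert x) :
    x = [] ∨ ∃ x₀ a, x = x₀ ++ [a] ∧ VertLetter a := by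
  rcases List.eq_nil_or_concat' x with rfl | ⟨x₀, a, rfl⟩
  · exact .inl rfl
  · exact .inr ⟨x₀, a, rfl, hx a (by simp)⟩

theorem placedOf_nil : placedOf ([] : List (Omega π)) = ∅ := by
  ext p
  simp [placedOf, Occurs]

/-- Before the last vertical letter only earlier nodes occur, and the last node is entered about
the final time. -/
theorem EndsVert.mem_placedOf (hK : Bounds π K) {x : List (Omega π)} (hx : EndsVert x)
    (hl : ∀ L ∈ x, CorrectLetter L) {p : Placed R} (hp : p ∈ placedOf x) :
    p.1 < height x ∧ (p.2.2.Vertical π → p.1 + 1 = height x → |p.2.1 - endTime x| ≤ K) := by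
  rcases hx.eq_nil_or with rfl | ⟨x₀, a, rfl, ha⟩
  · simp [placedOf_nil] at hp
  · have hsv : StartsVert [a] := by simpa [StartsVert] using ha
    obtain ⟨B, -, -, -, hB⟩ := ha.exists_body
    rw [placedOf_append (.inr hsv), hB] at hp
    rw [height_append, height_vert ha, (times_endTime_append x₀ [a] (.inr hsv)).2,
      endTime_vert ha]
    rcases hp with hp | hp
    · obtain ⟨-, -, h1, h2⟩ := TDatalog.mem_placedOf (fun L hL => hl L (by simp [hL])) hp
      refine ⟨by omega, fun hv => ?_⟩
      have := h2 hv
      intro h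
      push_cast at h
      omega
    · rw [Set.image_singleton, Set.mem_singleton_iff] at hp
      subst hp
      simp only [Placed.shift]
      have := abs_letterShift_le hK ha
      refine ⟨by push_cast; omega, fun _ _ => ?_⟩
      rw [abs_le] at this ⊢
      omega

theorem StartsVert.mem_placedOf {y : List (Omega π)} (hy : StartsVert y)
    (hl : ∀ L ∈ y, CorrectLetter L) {p : Placed R} (hp : p ∈ placedOf y) (h0 : p.1 = 0) :
    p.2.1 = 0 ∧ p.2.2.Vertical π := by
  cases y with
  | nil => simp [placedOf_nil] at hp
  | cons a z =>
    have ha : VertLetter a := hy a (by simp)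
    have hea : EndsVert [a] := by simpa [EndsVert] using ha
    obtain ⟨B, -, hv, -, hB⟩ := ha.exists_body
    rw [show a :: z = [a] ++ z from rfl, placedOf_append (.inl hea), hB, height_vert ha] at hp
    rcases hp with hp | hp
    · rw [Set.mem_singleton_iff] at hp
      subst hp
      exact ⟨rfl, hv⟩
    · rw [mem_shift_image] at hp
      have := (TDatalog.mem_placedOf (fun L hL => hl L (by simp [hL])) hp).2.1
      simp only at this
      omega

theorem EndsVert.eq_nil_of_height {x : List (Omega π)} (hx : EndsVert x) (h : height x = 0) :
    x = [] := by
  rcases hx.eq_nil_or with rfl | ⟨x₀, a, rfl, ha⟩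
  · rfl
  · rw [height_append, height_vert ha] at h
    omega

open Classical in
theorem markerIdx_append (s : Symb π) (σ ρ : List (Omega π)) : markerIdx s (σ ++ ρ) =
    if ∃ L ∈ σ, s ∈ L then markerIdx s σ else σ.length + markerIdx s ρ := by
  unfold markerIdx
  rw [List.findIdx_append]
  by_cases h : ∃ L ∈ σ, s ∈ L
  · rw [if_pos h, if_pos]
    rw [List.findIdx_lt_length]
    simpa using h
  · rw [if_neg h, if_neg, add_comm]
    rw [List.findIdx_lt_length]
    simpa using h

theorem markerIdx_lt {s : Symb π} {σ : List (Omega π)} (h : ∃ L ∈ σ, s ∈ L) :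
    markerIdx s σ < σ.length := by
  classical
  unfold markerIdx
  rw [List.findIdx_lt_length]
  simpa using h

/-- The placed bodies of a word with a distinguished horizontal part `σ ++ ρ`. -/
theorem placedOf_split {x σ ρ y : List (Omega π)} (hx : EndsVert x) (hσ : HorizSegment σ)
    (hρ : HorizSegment ρ) (hy : StartsVert y) :
    placedOf (x ++ ((σ ++ ρ) ++ y)) = placedOf x ∪
      (Placed.shift (height x) (endTime x - markerIdx Symb.bot (σ ++ ρ)) '' horizPlaced σ ∪
       (Placed.shift (height x) (endTime x - markerIdx Symb.bot (σ ++ ρ) + σ.length) ''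
          horizPlaced ρ ∪
        Placed.shift (height x) (endTime x - markerIdx Symb.bot (σ ++ ρ) +
          markerIdx Symb.top (σ ++ ρ)) '' placedOf y)) := by
  have hσρ : HorizSegment (σ ++ ρ) := by
    intro L hL
    rcases List.mem_append.1 hL with h | h
    · exact hσ L h
    · exact hρ L h
  rw [placedOf_append (.inl hx), placedOf_append (.inr hy), placedOf_horiz hσρ,
    horizPlaced_append, endTime_horiz hσρ, height_horiz hσρ]
  simp only [Set.image_union, shift_image_image, Set.union_assoc]
  refine congrArg₂ (· ∪ ·) rfl (congrArg₂ (· ∪ ·) ?_ (congrArg₂ (· ∪ ·) ?_ ?_)) <;> congr 2 <;>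
    push_cast <;> ring

theorem placedOf_append_horiz {x σ : List (Omega π)} (hx : EndsVert x) (hσ : HorizSegment σ) :
    placedOf (x ++ σ) = placedOf x ∪
      Placed.shift (height x) (endTime x - markerIdx Symb.bot σ) '' horizPlaced σ := by
  rw [placedOf_append (.inl hx), placedOf_horiz hσ, shift_image_image]
  congr 3
  · ring_nf
  · ring_nf

end TDatalog

/-! ### Replacement of prefixes -/

namespace TDatalog

variable {R : Type*} {π : Program R} {K : ℕ}

/-- A criterion for `CutContext` in terms of the positions of placed bodies. -/
theorem CutContext.of_positions {A QT QP : Set (Placed R)} {h T P : ℤ} {g : PObj R × ℤ}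
    {right : Prop} (order : P ≤ T)
    (hA : ∀ p ∈ A, p.2.2 ∈ π.bodies ∧ p.1 ≤ h ∧ (p.2.2.Vertical π → p.1 + 1 ≤ h))
    (hAt : right → ∀ p ∈ A, (p.1 = h → p.2.1 < T) ∧
      (p.2.2.Vertical π → p.1 + 1 = h → p.2.1 ≤ T + K))
    (hright : right ∨ QT = ∅)
    (hQT : ∀ q ∈ QT, q.2.2 ∈ π.bodies ∧ (q.1 = h → T ≤ q.2.1) ∧
      (q.1 < h → (∀ p ∈ A, p.1 = h) ∧
        (q.2.2.Vertical π → q.1 + 1 = h → T - K ≤ q.2.1)))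
    (hQP : ∀ q ∈ QP, q.2.2 ∈ π.bodies ∧ h ≤ q.1 ∧ (q.1 = h → q.2.2.Vertical π ∧ q.2.1 = P))
    (hTP : (∀ q ∈ QT, q.1 ≤ h ∧ (q.1 = h → ¬ q.2.2.Vertical π)) ∨ QP = ∅)
    (hg : g.1 = .node h ∨ ∃ m, g.1 = .node m ∧ m ≤ h ∧ ∀ q ∈ QT, h ≤ q.1)
    (hgt : right → g.1 = .node h → g.2 ≤ T + 3 * K) :
    CutContext π K A h T P g right QT QP := by
  have below : ∀ p ∈ A, ∀ v m, ob π p v = .node m → m ≤ h := by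
    intro p hp v m e
    obtain ⟨-, h1, h2⟩ := hA p hp
    rcases ob_eq_node e with rfl | ⟨h3, rfl⟩
    · exact h1
    · exact h2 h3
  have above : ∀ q : Placed R, h ≤ q.1 → ∀ v m, ob π q v = .node m → h ≤ m := by
    intro q hq v m e
    rcases ob_eq_node e with rfl | ⟨h3, rfl⟩ <;> omega
  have below' : ∀ q : Placed R, q.1 < h → ∀ v m, ob π q v = .node m → m ≤ h := by
    intro q hq v m e
    rcases ob_eq_node e with rfl | ⟨h3, rfl⟩ <;> omega
  have goal : ∀ q : Placed R, h ≤ q.1 → (∃ m, g.1 = .node m ∧ m ≤ h) → ∀ v, ob π q v = g.1 →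
      g.1 = .node h := by
    rintro q hq ⟨m, e, hm⟩ v e'
    have := above q hq v m (e'.trans e)
    rw [e, show m = h by omega]
  refine
    { bodies_A := fun p hp => (hA p hp).1
      bodies_T := fun p hp => (hQT p hp).1
      bodies_P := fun p hp => (hQP p hp).1
      idx_A := ?_
      order := order
      time_A := ?_
      time_T := ?_
      time_P := ?_
      meet_T := ?_
      meet_P := ?_
      meet_TP := ?_
      goal_T := ?_
      goal_P := ?_
      goal_time := hgt }
  · intro p hp v _
    cases e : ob π p v with
    | node m => exact below p hp v m e
    | loc q w => exact (ob_eq_loc e).1 ▸ (hA p hp).2.1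
  · intro hr p hp v _ e
    obtain ⟨h1, h2⟩ := hAt hr p hp
    rcases ob_eq_node e with h3 | ⟨h3, h4⟩
    · have := h1 h3.symm
      omega
    · exact h2 h3 h4.symm
  · intro q hq v _ e
    obtain ⟨-, h1, h2⟩ := hQT q hq
    refine ⟨hright.resolve_right fun h => by simp [h] at hq, ?_⟩
    rcases ob_eq_node e with h3 | ⟨h3, h4⟩
    · have := h1 h3.symm
      omega
    · exact (h2 (by omega)).2 h3 h4.symm
  · intro q hq v _ e
    obtain ⟨-, h1, h2⟩ := hQP q hq
    rcases ob_eq_node e with h3 | ⟨h3, h4⟩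
    · exact (h2 h3.symm).2
    · omega
  · intro q hq v _ p hp w _ e
    obtain ⟨-, h1, h2⟩ := hQT q hq
    cases e' : ob π p w with
    | node m =>
      have hm := below p hp w m e'
      rw [e'] at e
      rw [e]
      rcases lt_or_ge q.1 h with hlt | hge
      · obtain ⟨h3, -⟩ := h2 hlt
        have h4 := h3 p hp
        rcases ob_eq_node e' with rfl | ⟨h5, rfl⟩
        · rw [h4]
        · rw [le_antisymm hm (by omega)]
      · rw [le_antisymm hm (above q hge v m e)]
    | loc p' w' =>
      obtain ⟨rfl, rfl⟩ := ob_eq_loc e'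
      obtain ⟨rfl, rfl⟩ := ob_eq_loc (e.trans e')
      exfalso
      by_cases hr : right
      · obtain ⟨h3, h4, h5⟩ := hA q hp
        rcases h4.lt_or_eq with h6 | h6
        · have := (h2 h6).1 q hp
          omega
        · have := h1 h6
          have := (hAt hr q hp).1 h6
          omega
      · rcases hright with h7 | h7
        · exact hr h7
        · simp [h7] at hq
  · intro q hq v _ p hp w _ e
    obtain ⟨-, h1, h2⟩ := hQP q hq
    cases e' : ob π p w with
    | node m =>
      rw [e'] at e
      rw [e, le_antisymm (below p hp w m e') (above q h1 v m e)]
    | loc p' w' =>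
      obtain ⟨rfl, rfl⟩ := ob_eq_loc e'
      obtain ⟨rfl, rfl⟩ := ob_eq_loc (e.trans e')
      obtain ⟨h3, h4, h5⟩ := hA q hp
      have := h5 (h2 (by omega)).1
      omega
  · intro q hq v _ p hp w _ e
    have hne : ∀ q ∈ QT, q.1 ≤ h ∧ (q.1 = h → ¬ q.2.2.Vertical π) :=
      hTP.resolve_right fun h => by simp [h] at hp
    obtain ⟨h1, h2⟩ := hne q hq
    obtain ⟨-, h3, h4⟩ := hQP p hp
    cases e' : ob π p w with
    | node m =>
      rw [e'] at e
      rw [e]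
      have h5 := above p h3 w m e'
      have h6 : m ≤ h := by
        rcases ob_eq_node e with rfl | ⟨h7, rfl⟩
        · exact h1
        · rcases h1.lt_or_eq with h8 | h8
          · omega
          · exact absurd h7 (h2 h8)
      rw [le_antisymm h6 h5]
    | loc p' w' =>
      obtain ⟨rfl, rfl⟩ := ob_eq_loc e'
      obtain ⟨rfl, rfl⟩ := ob_eq_loc (e.trans e')
      exact absurd (h4 (by omega)).1 (h2 (by omega))
  · intro q hq v _ e
    rcases hg with h1 | ⟨m, h1, h2, h3⟩
    · exact h1
    · exact goal q (h3 q hq) ⟨m, h1, h2⟩ v e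
  · intro q hq v _ e
    rcases hg with h1 | ⟨m, h1, h2, h3⟩
    · exact h1
    · exact goal q (hQP q hq).2.1 ⟨m, h1, h2⟩ v e

/-- The moment-object for which the goal relation is to be derived. -/
abbrev start : PObj R × ℤ := (.node 0, 0)

variable {ar : R → ℕ} {G : R}

/-- Replacement of everything before a vertical letter. -/
theorem derives_replace_vert (hq : IsQuery ar π G) (hK : Bounds π K)
    {x x' : List (Omega π)} {a : Omega π} (ha : VertLetter a)
    (H : data π K (placedOf x) (height x) (endTime x) (endTime x) start =
      data π K (placedOf x') (height x') (endTime x') (endTime x') start)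
    {z : List (Omega π)} (hl : ∀ L ∈ x ++ a :: z, CorrectLetter L)
    (hd : Derives π (placedDB π (placedOf (x ++ a :: z))) (G, start)) :
    Derives π (placedDB π (placedOf (x' ++ a :: z))) (G, start) := by
  have hsv : StartsVert (a :: z) := by simpa [StartsVert] using ha
  rw [placedOf_append (.inr hsv)] at hd ⊢
  have hlx : ∀ L ∈ x, CorrectLetter L := fun L hL => hl L (by simp [hL])
  have hlz : ∀ L ∈ a :: z, CorrectLetter L := fun L hL => hl L (by
    rw [List.mem_append]; exact .inr hL)
  have C : CutContext π K (placedOf x) (height x) (endTime x) (endTime x) start False ∅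
      (Placed.shift (height x) (endTime x) '' placedOf (a :: z)) := by
    refine CutContext.of_positions le_rfl ?_ False.elim (.inr rfl) (by simp) ?_ (.inl (by simp))
      (.inr ⟨0, rfl, by omega, by simp⟩) False.elim
    · intro p hp
      obtain ⟨h1, h2, h3, h4⟩ := mem_placedOf hlx hp
      exact ⟨h1, h3, h4⟩
    · intro q hq
      rw [mem_shift_image] at hq
      obtain ⟨h1, h2, h3, h4⟩ := mem_placedOf hlz hq
      simp only at h1 h2
      refine ⟨h1, by omega, fun h5 => ?_⟩
      obtain ⟨h6, h7⟩ := hsv.mem_placedOf hlz hq (by simp only; omega)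
      simp only at h6 h7
      exact ⟨h7, by omega⟩
  have := C.derives hq hK H (S := G) (m := start) (m' := start) (.inl ⟨rfl, rfl⟩)
    (by simpa using hd)
  simpa [shift_image_image] using this

open Classical in
/-- The part of the bodies after the current horizontal segment that is placed relative to the
current position, as opposed to a marker `⊤` that has been read already. -/
noncomputable def lateExit (σ : List (Omega π)) (Q : Set (Placed R)) : Set (Placed R) :=
  if ∃ L ∈ σ, Symb.top ∈ L then ∅ else Q

open Classical in
/-- The complementary part to `lateExit`. -/
noncomputable def earlyExit (σ : List (Omega π)) (Q : Set (Placed R)) : Set (Placed R) :=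
  if ∃ L ∈ σ, Symb.top ∈ L then Q else ∅

open Classical in
/-- The position of the letter with `⊤` in a partial horizontal segment, relative to its end, or
`0` if there is no such letter. -/
noncomputable def topPos (σ : List (Omega π)) : ℤ :=
  if ∃ L ∈ σ, Symb.top ∈ L then (markerIdx Symb.top σ : ℤ) - σ.length else 0

theorem topPos_le (σ : List (Omega π)) : topPos σ ≤ 0 := by
  unfold topPos
  split_ifs with h
  · have := markerIdx_lt h
    omega
  · exact le_rfl

theorem shift_union_exit (σ ρ : List (Omega π)) (a b : ℤ) (Q : Set (Placed R)) :
    Placed.shift a (b + markerIdx Symb.top (σ ++ ρ)) '' Q =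
      Placed.shift a (b + σ.length + markerIdx Symb.top ρ) '' lateExit σ Q ∪
      Placed.shift a (b + σ.length + topPos σ) '' earlyExit σ Q := by
  rw [markerIdx_append]
  unfold lateExit earlyExit topPos
  split_ifs
  · simp
  · simp [add_assoc]

theorem mem_lateExit {σ : List (Omega π)} {Q : Set (Placed R)} {q : Placed R} :
    q ∈ lateExit σ Q ↔ (¬ ∃ L ∈ σ, Symb.top ∈ L) ∧ q ∈ Q := by
  unfold lateExit
  split_ifs with h <;> simp [h]

theorem mem_earlyExit {σ : List (Omega π)} {Q : Set (Placed R)} {q : Placed R} :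
    q ∈ earlyExit σ Q ↔ (∃ L ∈ σ, Symb.top ∈ L) ∧ q ∈ Q := by
  unfold earlyExit
  split_ifs with h <;> simp [h]

/-- The bodies of the rest `ρ ++ y` of a word after the partial horizontal segment `σ` that are
placed relative to the current position. -/
noncomputable def lateRest (σ ρ y : List (Omega π)) : Set (Placed R) :=
  horizPlaced ρ ∪ Placed.shift 0 (markerIdx Symb.top ρ) '' lateExit σ (placedOf y)

/-- The position of the current letter relative to the time at which the segment is attached, if
`⊥` has been read. -/
noncomputable def botPos (σ : List (Omega π)) : ℤ := σ.length - markerIdx Symb.bot σ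

theorem placedOf_split_bot {x σ ρ y : List (Omega π)} (hx : EndsVert x) (hσ : HorizSegment σ)
    (hρ : HorizSegment ρ) (hy : StartsVert y) (hbot : ∃ L ∈ σ, Symb.bot ∈ L) :
    placedOf (x ++ ((σ ++ ρ) ++ y)) = placedOf (x ++ σ) ∪
      (Placed.shift (height x) (endTime x + botPos σ) '' lateRest σ ρ y ∪
       Placed.shift (height x) (endTime x + botPos σ + topPos σ) ''
         earlyExit σ (placedOf y)) := by
  rw [placedOf_split hx hσ hρ hy, placedOf_append_horiz hx hσ, shift_union_exit, markerIdx_append,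
    if_pos hbot, lateRest, Set.image_union, shift_image_image]
  simp only [Set.union_assoc, botPos]
  refine congrArg₂ (· ∪ ·) rfl (congrArg₂ (· ∪ ·) rfl (congrArg₂ (· ∪ ·) ?_
    (congrArg₂ (· ∪ ·) ?_ ?_))) <;> congr 2 <;> ring

theorem placedOf_split_no_bot {x σ ρ y : List (Omega π)} (hx : EndsVert x) (hσ : HorizSegment σ)
    (hρ : HorizSegment ρ) (hy : StartsVert y) (hbot : ¬ ∃ L ∈ σ, Symb.bot ∈ L) :
    placedOf (x ++ ((σ ++ ρ) ++ y)) =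
      Placed.shift (height x) (endTime x - markerIdx Symb.bot ρ) ''
        (Placed.shift 0 (-(σ.length : ℤ)) '' horizPlaced σ ∪
          ((Placed.shift (-height x) (markerIdx Symb.bot ρ - endTime x) '' placedOf x ∪
            lateRest σ ρ y) ∪ Placed.shift 0 (topPos σ) '' earlyExit σ (placedOf y))) := by
  rw [placedOf_split hx hσ hρ hy, shift_union_exit, markerIdx_append, if_neg hbot, lateRest]
  simp only [Set.image_union, shift_image_image, Set.union_assoc]
  rw [Set.union_left_comm]
  refine congrArg₂ (· ∪ ·) ?_ (congrArg₂ (· ∪ ·) ?_ (congrArg₂ (· ∪ ·) ?_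
    (congrArg₂ (· ∪ ·) ?_ ?_)))
  · congr 2 <;> push_cast <;> ring
  · rw [show -(height x : ℤ) + height x = 0 by ring, show (markerIdx Symb.bot ρ : ℤ) - endTime x +
      (endTime x - markerIdx Symb.bot ρ) = 0 by ring, shift_zero_image]
  all_goals congr 2 <;> push_cast <;> ring

theorem lateRest_congr {σ σ' : List (Omega π)}
    (h : (∃ L ∈ σ, Symb.top ∈ L) ↔ ∃ L ∈ σ', Symb.top ∈ L) (ρ y : List (Omega π)) :
    lateRest σ ρ y = lateRest σ' ρ y := by
  unfold lateRest lateExit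
  by_cases hσ : ∃ L ∈ σ, Symb.top ∈ L
  · rw [if_pos hσ, if_pos (h.1 hσ)]
  · rw [if_neg hσ, if_neg (mt h.2 hσ)]

theorem earlyExit_congr {σ σ' : List (Omega π)}
    (h : (∃ L ∈ σ, Symb.top ∈ L) ↔ ∃ L ∈ σ', Symb.top ∈ L) (Q : Set (Placed R)) :
    earlyExit σ Q = earlyExit σ' Q := by
  unfold earlyExit
  by_cases hσ : ∃ L ∈ σ, Symb.top ∈ L
  · rw [if_pos hσ, if_pos (h.1 hσ)]
  · rw [if_neg hσ, if_neg (mt h.2 hσ)]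

theorem mem_lateRest {σ ρ y : List (Omega π)} (hρ : HorizSegment ρ) (hy : StartsVert y)
    (hl : ∀ L ∈ ρ ++ y, CorrectLetter L) {q : Placed R} (hq : q ∈ lateRest σ ρ y) :
    q.2.2 ∈ π.bodies ∧ 0 ≤ q.1 ∧ (q.1 = 0 → 0 ≤ q.2.1) ∧
      ((∃ L ∈ σ, Symb.top ∈ L) → q.1 = 0 ∧ ¬ q.2.2.Vertical π) := by
  rcases hq with hq | hq
  · obtain ⟨h1, h2, h3, -, h4⟩ := mem_horizPlaced (fun L hL => hl L (by simp [hL])) hρ hq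
    exact ⟨h1, by omega, fun _ => h3, fun _ => ⟨h2, h4⟩⟩
  · rw [mem_shift_image, mem_lateExit] at hq
    obtain ⟨h1, h2⟩ := hq
    have hly : ∀ L ∈ y, CorrectLetter L := fun L hL => hl L (by simp [hL])
    obtain ⟨h3, h4, -, -⟩ := mem_placedOf hly h2
    simp only [sub_zero] at h4
    refine ⟨h3, h4, fun h => ?_, fun h => absurd h h1⟩
    have := (hy.mem_placedOf hly h2 (by simpa using h)).1
    simp only at this
    omega

theorem mem_earlyExit_placedOf {σ y : List (Omega π)} (hy : StartsVert y)
    (hl : ∀ L ∈ y, CorrectLetter L) {q : Placed R} (hq : q ∈ earlyExit σ (placedOf y)) :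
    q.2.2 ∈ π.bodies ∧ 0 ≤ q.1 ∧ (q.1 = 0 → q.2.2.Vertical π ∧ q.2.1 = 0) := by
  rw [mem_earlyExit] at hq
  obtain ⟨h3, h4, -, -⟩ := mem_placedOf hl hq.2
  exact ⟨h3, h4, fun h => (hy.mem_placedOf hl hq.2 h).symm⟩

/-- Replacement of a prefix that ends inside a horizontal segment after the letter with `⊥`. -/
theorem derives_replace_bot (hq : IsQuery ar π G) (hK : Bounds π K)
    {x x' σ σ' ρ y : List (Omega π)} (hx : EndsVert x) (hx' : EndsVert x')
    (hσ : HorizSegment σ) (hσ' : HorizSegment σ') (hρ : HorizSegment ρ) (hy : StartsVert y)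
    (hbot : ∃ L ∈ σ, Symb.bot ∈ L) (hbot' : ∃ L ∈ σ', Symb.bot ∈ L)
    (htop : (∃ L ∈ σ, Symb.top ∈ L) ↔ ∃ L ∈ σ', Symb.top ∈ L)
    (H : data π K (placedOf (x ++ σ)) (height x) (endTime x + botPos σ)
        (endTime x + botPos σ + topPos σ) start =
      data π K (placedOf (x' ++ σ')) (height x') (endTime x' + botPos σ')
        (endTime x' + botPos σ' + topPos σ') start)
    (hl : ∀ L ∈ x ++ ((σ ++ ρ) ++ y), CorrectLetter L)
    (hd : Derives π (placedDB π (placedOf (x ++ ((σ ++ ρ) ++ y)))) (G, start)) :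
    Derives π (placedDB π (placedOf (x' ++ ((σ' ++ ρ) ++ y)))) (G, start) := by
  rw [placedOf_split_bot hx hσ hρ hy hbot] at hd
  rw [placedOf_split_bot hx' hσ' hρ hy hbot', ← lateRest_congr htop, ← earlyExit_congr htop]
  have hlx : ∀ L ∈ x, CorrectLetter L := fun L hL => hl L (by simp [hL])
  have hlσ : ∀ L ∈ σ, CorrectLetter L := fun L hL => hl L (by simp [hL])
  have hlρ : ∀ L ∈ ρ ++ y, CorrectLetter L := fun L hL => hl L (by
    rw [List.mem_append] at hL
    rcases hL with hL | hL <;> simp [hL])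
  have hbp : 0 < botPos σ := by
    have := markerIdx_lt hbot
    unfold botPos
    omega
  have hheight : height (x ++ σ) = height x := by rw [height_append, height_horiz hσ, add_zero]
  have C : CutContext π K (placedOf (x ++ σ)) (height x) (endTime x + botPos σ)
      (endTime x + botPos σ + topPos σ) start True
      (Placed.shift (height x) (endTime x + botPos σ) '' lateRest σ ρ y)
      (Placed.shift (height x) (endTime x + botPos σ + topPos σ) '' earlyExit σ (placedOf y)) := by
    refine CutContext.of_positions (by have := topPos_le σ; omega) ?_ (fun _ => ?_)
      (.inl trivial) ?_ ?_ ?_ (.inr ⟨0, rfl, by omega, ?_⟩) (fun _ => ?_)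
    · intro p hp
      obtain ⟨h1, h2, h3, h4⟩ := mem_placedOf (w := x ++ σ) (fun L hL => by
        rcases List.mem_append.1 hL with h | h
        · exact hlx L h
        · exact hlσ L h) hp
      rw [hheight] at h3 h4
      exact ⟨h1, h3, h4⟩
    · intro p hp
      rw [placedOf_append_horiz hx hσ] at hp
      rcases hp with hp | hp
      · obtain ⟨h1, h2⟩ := hx.mem_placedOf hK hlx hp
        refine ⟨fun h => by omega, fun hv h => ?_⟩
        have := h2 hv h
        rw [abs_le] at this
        omega
      · rw [mem_shift_image] at hp
        obtain ⟨-, h2, h3, h4, h5⟩ := mem_horizPlaced hlσ hσ hp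
        simp only at h2 h3 h4 h5
        unfold botPos
        exact ⟨fun _ => by omega, fun hv => absurd hv h5⟩
    · intro q hq
      rw [mem_shift_image] at hq
      obtain ⟨h1, h2, h3, -⟩ := mem_lateRest hρ hy hlρ hq
      simp only at h1 h2 h3
      exact ⟨h1, fun h => by have := h3 (by omega); omega, fun h => by omega⟩
    · intro q hq
      rw [mem_shift_image] at hq
      obtain ⟨h1, h2, h3⟩ := mem_earlyExit_placedOf hy (fun L hL => hlρ L (by simp [hL])) hq
      simp only at h1 h2 h3
      refine ⟨h1, by omega, fun h => ?_⟩
      obtain ⟨h4, h5⟩ := h3 (by omega)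
      exact ⟨h4, by omega⟩
    · by_cases ht : ∃ L ∈ σ, Symb.top ∈ L
      · left
        intro q hq
        rw [mem_shift_image] at hq
        obtain ⟨-, -, -, h⟩ := mem_lateRest hρ hy hlρ hq
        obtain ⟨h1, h2⟩ := h ht
        simp only at h1 h2
        exact ⟨by omega, fun _ => h2⟩
      · right
        simp [earlyExit, ht]
    · intro q hq
      rw [mem_shift_image] at hq
      have := (mem_lateRest hρ hy hlρ hq).2.1
      simp only at this
      omega
    · intro h
      have h0 : height x = 0 := by
        have : (0 : ℤ) = height x := by simpa [start] using h
        omega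
      obtain rfl := hx.eq_nil_of_height h0
      have : endTime ([] : List (Omega π)) = 0 := rfl
      simp only
      omega
  have := C.derives hq hK H (S := G) (m := start) (m' := start) (.inl ⟨rfl, rfl⟩) hd
  simpa only [shift_image_image, add_sub_cancel] using this

/-- Replacement of an infix that is the beginning of a horizontal segment, before the letter
with `⊥`. -/
theorem derives_replace_no_bot (hq : IsQuery ar π G) (hK : Bounds π K)
    {x σ σ' ρ y : List (Omega π)} (hx : EndsVert x)
    (hσ : HorizSegment σ) (hσ' : HorizSegment σ') (hρ : HorizSegment ρ) (hy : StartsVert y)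
    (hbot : ¬ ∃ L ∈ σ, Symb.bot ∈ L) (hbot' : ¬ ∃ L ∈ σ', Symb.bot ∈ L)
    (htop : (∃ L ∈ σ, Symb.top ∈ L) ↔ ∃ L ∈ σ', Symb.top ∈ L)
    (H : data π K (Placed.shift 0 (-(σ.length : ℤ)) '' horizPlaced σ) 0 0 (topPos σ) start =
      data π K (Placed.shift 0 (-(σ'.length : ℤ)) '' horizPlaced σ') 0 0 (topPos σ') start)
    (hl : ∀ L ∈ x ++ ((σ ++ ρ) ++ y), CorrectLetter L)
    (hd : Derives π (placedDB π (placedOf (x ++ ((σ ++ ρ) ++ y)))) (G, start)) :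
    Derives π (placedDB π (placedOf (x ++ ((σ' ++ ρ) ++ y)))) (G, start) := by
  rw [placedOf_split_no_bot hx hσ hρ hy hbot] at hd
  rw [placedOf_split_no_bot hx hσ' hρ hy hbot', ← lateRest_congr htop, ← earlyExit_congr htop]
  -- The current position becomes the origin, so that the other bodies do not move.
  have hd := hd.shift (-(height x : ℤ)) (markerIdx Symb.bot ρ - endTime x)
  rw [shift_image_image, add_neg_cancel, sub_add_sub_cancel', sub_self, shift_zero_image] at hd
  suffices hs : Derives π (placedDB π (Placed.shift 0 (-(σ'.length : ℤ)) '' horizPlaced σ' ∪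
      ((Placed.shift (-height x) (markerIdx Symb.bot ρ - endTime x) '' placedOf x ∪
        lateRest σ ρ y) ∪ Placed.shift 0 (topPos σ') '' earlyExit σ (placedOf y))))
      (G, mshift (-(height x : ℤ)) (markerIdx Symb.bot ρ - endTime x) start) by
    have := hs.shift (height x) (endTime x - markerIdx Symb.bot ρ)
    rwa [mshift_mshift, neg_add_cancel, sub_add_sub_cancel', sub_self, mshift_zero] at this
  have hlx : ∀ L ∈ x, CorrectLetter L := fun L hL => hl L (by simp [hL])
  have hlσ : ∀ L ∈ σ, CorrectLetter L := fun L hL => hl L (by simp [hL])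
  have hlρ : ∀ L ∈ ρ ++ y, CorrectLetter L := fun L hL => hl L (by
    rw [List.mem_append] at hL
    rcases hL with hL | hL <;> simp [hL])
  have hA : ∀ p ∈ Placed.shift 0 (-(σ.length : ℤ)) '' horizPlaced σ,
      p.2.2 ∈ π.bodies ∧ p.1 = 0 ∧ p.2.1 < 0 ∧ ¬ p.2.2.Vertical π := by
    intro p hp
    rw [mem_shift_image] at hp
    obtain ⟨h1, h2, h3, h4, h5⟩ := mem_horizPlaced hlσ hσ hp
    simp only [sub_zero] at h1 h2 h3 h4 h5
    exact ⟨h1, h2, by omega, h5⟩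
  have hP : ∀ q ∈ Placed.shift 0 (topPos σ) '' earlyExit σ (placedOf y),
      q.2.2 ∈ π.bodies ∧ 0 ≤ q.1 ∧ (q.1 = 0 → q.2.2.Vertical π ∧ q.2.1 = topPos σ) := by
    intro q hq
    rw [mem_shift_image] at hq
    obtain ⟨h1, h2, h3⟩ := mem_earlyExit_placedOf hy (fun L hL => hlρ L (by simp [hL])) hq
    simp only [sub_zero] at h1 h2 h3
    refine ⟨h1, h2, fun h => ?_⟩
    obtain ⟨h4, h5⟩ := h3 h
    exact ⟨h4, by omega⟩
  have hX : ∀ q ∈ Placed.shift (-height x) (markerIdx Symb.bot ρ - endTime x) '' placedOf x,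
      q.2.2 ∈ π.bodies ∧ q.1 < 0 ∧ (q.2.2.Vertical π → q.1 + 1 = 0 → -K ≤ q.2.1) := by
    intro q hq
    rw [mem_shift_image] at hq
    obtain ⟨h1, -⟩ := mem_placedOf hlx hq
    obtain ⟨h2, h3⟩ := hx.mem_placedOf hK hlx hq
    simp only at h1 h2 h3
    refine ⟨h1, by omega, fun hv h => ?_⟩
    have := h3 hv (by omega)
    rw [abs_le] at this
    omega
  have C : CutContext π K (Placed.shift 0 (-(σ.length : ℤ)) '' horizPlaced σ) 0 0
      (topPos σ) start True
      (Placed.shift (-height x) (markerIdx Symb.bot ρ - endTime x) '' placedOf x ∪ lateRest σ ρ y)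
      (Placed.shift 0 (topPos σ) '' earlyExit σ (placedOf y)) := by
    refine CutContext.of_positions (topPos_le σ) ?_ (fun _ => ?_)
      (.inl trivial) ?_ ?_ ?_ (.inl rfl) (fun _ _ => ?_)
    · intro p hp
      obtain ⟨h1, h2, h3, h4⟩ := hA p hp
      exact ⟨h1, h2.le, fun h => absurd h h4⟩
    · intro p hp
      obtain ⟨h1, h2, h3, h4⟩ := hA p hp
      exact ⟨fun _ => h3, fun h => absurd h h4⟩
    · rintro q (hq | hq)
      · obtain ⟨h1, h2, h3⟩ := hX q hq
        exact ⟨h1, fun h => by omega, fun _ => ⟨fun p hp => (hA p hp).2.1, by simpa using h3⟩⟩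
      · obtain ⟨h1, h2, h3, -⟩ := mem_lateRest hρ hy hlρ hq
        exact ⟨h1, h3, fun h => by omega⟩
    · exact hP
    · by_cases ht : ∃ L ∈ σ, Symb.top ∈ L
      · left
        rintro q (hq | hq)
        · obtain ⟨h1, h2, h3⟩ := hX q hq
          exact ⟨h2.le, fun h => by omega⟩
        · obtain ⟨-, -, -, h⟩ := mem_lateRest hρ hy hlρ hq
          obtain ⟨h1, h2⟩ := h ht
          exact ⟨h1.le, fun _ => h2⟩
      · right
        simp [earlyExit, ht]
    · simp only
      positivity
  have := C.derives hq hK H (S := G)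
    (m := mshift (-(height x : ℤ)) (markerIdx Symb.bot ρ - endTime x) start)
    (m' := mshift (-(height x : ℤ)) (markerIdx Symb.bot ρ - endTime x) start) (.inr ⟨?_, ?_, ?_⟩) hd
  · simpa [shift_image_image, shift_zero_image] using this
  · rw [mshift_mshift]
    simp
  · intro h
    have h0 : height x = 0 := by
      have : (0 : ℤ) + -height x = 0 := by simpa [start, mshift, PObj.shift] using h
      omega
    obtain rfl := hx.eq_nil_of_height h0
    have : endTime ([] : List (Omega π)) = 0 := rfl
    refine ⟨trivial, ?_⟩
    simp only [mshift]
    omega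
  · intro h
    have hh : 0 < height x := by
      rw [Nat.pos_iff_ne_zero]
      rintro h0
      exact h (by simp [mshift, PObj.shift, h0])
    refine ⟨h, ?_⟩
    intro p hp v _ e
    have e' : ob π p v = .node (-(height x : ℤ)) := by
      simpa [start, mshift, PObj.shift] using e
    have hp' : 0 ≤ p.1 := by
      rcases hp with hp | hp
      · exact (hA p hp).2.1.ge
      · exact (hP p hp).2.1
    rcases ob_eq_node e' with h1 | ⟨-, h1⟩ <;> omega

end TDatalog

/-! ### The invariant of a prefix -/

namespace TDatalog

variable {R : Type*} {π : Program R} {K : ℕ}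

open Classical in
/-- The longest prefix that is empty or ends with a vertical letter. -/
noncomputable def closedPart (u : List (Omega π)) : List (Omega π) :=
  u.rdropWhile fun L => decide ¬ VertLetter L

open Classical in
/-- The longest suffix without vertical letters. -/
noncomputable def openPart (u : List (Omega π)) : List (Omega π) :=
  u.rtakeWhile fun L => decide ¬ VertLetter L

theorem closedPart_append_openPart (u : List (Omega π)) : closedPart u ++ openPart u = u :=
  List.rdropWhile_append_rtakeWhile

open Classical in
theorem endsVert_closedPart (u : List (Omega π)) : EndsVert (closedPart u) := by
  intro L hL
  obtain ⟨hne, rfl⟩ := List.mem_getLast?_eq_getLast hL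
  have := List.rdropWhile_last_not (fun L => decide ¬ VertLetter L) u hne
  rw [decide_eq_true_eq, not_not] at this
  exact this

theorem horizSegment_openPart (u : List (Omega π)) : HorizSegment (openPart u) := by
  intro L hL
  simpa using List.mem_rtakeWhile_imp hL

open Classical in
theorem exists_horiz_vert (v : List (Omega π)) :
    ∃ ρ y, v = ρ ++ y ∧ HorizSegment ρ ∧ StartsVert y := by
  refine ⟨v.takeWhile fun L => decide ¬ VertLetter L, v.dropWhile fun L => decide ¬ VertLetter L,
    List.takeWhile_append_dropWhile.symm, ?_, ?_⟩
  · intro L hL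
    simpa using List.mem_takeWhile_imp hL
  · intro L hL
    have := List.head?_dropWhile_not (fun L => decide ¬ VertLetter L) v
    rw [hL] at this
    simpa using this

open Classical in
/-- The number of letters with a given marker, where `2` stands for all larger numbers. -/
noncomputable def markerCount (s : Symb π) (σ : List (Omega π)) : Fin 3 :=
  ⟨min 2 (σ.countP fun L => decide (s ∈ L)), by omega⟩

variable (π K) in
/-- The values of the invariant `invariant`. -/
abbrev Invariant :=
  (Prop × Prop × Prop × Prop × Fin 3 × Fin 3) × Option (Omega π) × Data π K × Data π K × Data π K

variable (K) in
/-- The invariant of a prefix `u = x ++ σ`, where `x` is empty or ends with a vertical letter and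
`σ` has no vertical letters: what is relevant for correctness, the last letter of `x`, and the
invariants of the bodies of `x` before this letter, of `σ`, and of `u`. -/
noncomputable def invariant (u : List (Omega π)) : Invariant π K :=
  let x := closedPart u
  let σ := openPart u
  ((Correct x, x = [], σ = [], (∀ L ∈ σ, CorrectLetter L), markerCount Symb.bot σ,
      markerCount Symb.top σ),
    x.getLast?,
    data π K (placedOf x.dropLast) (height x.dropLast) (endTime x.dropLast) (endTime x.dropLast)
      start,
    data π K (Placed.shift 0 (-(σ.length : ℤ)) '' horizPlaced σ) 0 0 (topPos σ) start,
    data π K (placedOf (x ++ σ)) (height x) (endTime x + botPos σ)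
      (endTime x + botPos σ + topPos σ) start)

theorem exists_mem_iff_of_markerCount_eq {s : Symb π} {σ σ' : List (Omega π)}
    (h : markerCount s σ = markerCount s σ') : (∃ L ∈ σ, s ∈ L) ↔ ∃ L ∈ σ', s ∈ L := by
  classical
  have key : ∀ σ : List (Omega π), (∃ L ∈ σ, s ∈ L) ↔ 0 < (markerCount s σ).1 := by
    intro σ
    have : (∃ L ∈ σ, s ∈ L) ↔ 0 < σ.countP fun L => decide (s ∈ L) := by
      rw [List.countP_pos_iff]; simp
    rw [this]
    simp only [markerCount]
    omega
  rw [key, key, h]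

open Classical in
theorem correct_split {x ρ y : List (Omega π)} (hx : EndsVert x) (hρ : HorizSegment ρ)
    (hy : StartsVert y) : Correct (x ++ (ρ ++ y)) ↔ Correct x ∧ Correct y ∧ (ρ ≠ [] →
      (∀ L ∈ ρ, CorrectLetter L) ∧ ρ.countP (fun L => decide (Symb.bot ∈ L)) = 1 ∧
        (y ≠ [] → ρ.countP (fun L => decide (Symb.top ∈ L)) = 1)) := by
  rw [correct_append hx]
  by_cases h : ρ = []
  · simp [h]
  · rw [correct_horiz_append hρ h hy]
    exact ⟨fun ⟨a, b, c⟩ => ⟨a, c, fun _ => b⟩, fun ⟨a, c, b⟩ => ⟨a, b h, c⟩⟩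

theorem correct_congr {x x' σ σ' ρ y : List (Omega π)} (hx : EndsVert x) (hx' : EndsVert x')
    (hσ : HorizSegment σ) (hσ' : HorizSegment σ') (hρ : HorizSegment ρ) (hy : StartsVert y)
    (h1 : Correct x → Correct x')
    (h3 : (∀ L ∈ σ, CorrectLetter L) → ∀ L ∈ σ', CorrectLetter L)
    (h4 : markerCount Symb.bot σ = markerCount Symb.bot σ')
    (h5 : markerCount Symb.top σ = markerCount Symb.top σ') (h6 : σ = [] → σ' = [])
    (h : Correct (x ++ ((σ ++ ρ) ++ y))) : Correct (x' ++ ((σ' ++ ρ) ++ y)) := by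
  classical
  have happ : ∀ {σ : List (Omega π)}, HorizSegment σ → HorizSegment (σ ++ ρ) := by
    intro σ hσ L hL
    rcases List.mem_append.1 hL with h | h
    · exact hσ L h
    · exact hρ L h
  rw [correct_split hx (happ hσ) hy] at h
  rw [correct_split hx' (happ hσ') hy]
  obtain ⟨c1, c2, c3⟩ := h
  refine ⟨h1 c1, c2, fun hne => ?_⟩
  obtain ⟨c4, c5, c6⟩ := c3 (by
    rintro he
    rw [List.append_eq_nil_iff] at he
    exact hne (by rw [h6 he.1, he.2]; rfl))
  have count : ∀ s : Symb π, markerCount s σ = markerCount s σ' →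
      (σ ++ ρ).countP (fun L => decide (s ∈ L)) = 1 →
      (σ' ++ ρ).countP (fun L => decide (s ∈ L)) = 1 := by
    intro s hs hc
    have hs := congrArg Fin.val hs
    simp only [markerCount] at hs
    rw [List.countP_append] at hc ⊢
    omega
  refine ⟨fun L hL => ?_, count _ h4 c5, fun hy => count _ h5 (c6 hy)⟩
  rcases List.mem_append.1 hL with hL | hL
  · exact h3 (fun L hL => c4 L (List.mem_append.2 (.inl hL))) L hL
  · exact c4 L (List.mem_append.2 (.inr hL))

variable {ar : R → ℕ} {G : R}

/-- Replacement of a prefix that is empty or ends with a vertical letter. -/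
theorem derives_replace_closed (hq : IsQuery ar π G) (hK : Bounds π K)
    {x x' : List (Omega π)} (hx : EndsVert x) (h1 : x.getLast? = x'.getLast?)
    (H : data π K (placedOf x.dropLast) (height x.dropLast) (endTime x.dropLast)
        (endTime x.dropLast) start =
      data π K (placedOf x'.dropLast) (height x'.dropLast) (endTime x'.dropLast)
        (endTime x'.dropLast) start)
    {z : List (Omega π)} (hl : ∀ L ∈ x ++ z, CorrectLetter L)
    (hd : Derives π (placedDB π (placedOf (x ++ z))) (G, start)) :
    Derives π (placedDB π (placedOf (x' ++ z))) (G, start) := by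
  rcases hx.eq_nil_or with rfl | ⟨x₀, a, rfl, ha⟩
  · have : x' = [] := by simpa [eq_comm] using h1
    rwa [this]
  · rcases List.eq_nil_or_concat' x' with rfl | ⟨x₀', a', rfl⟩
    · simp at h1
    · obtain rfl : a = a' := by simpa using h1
      simp only [List.dropLast_concat] at H
      rw [List.append_assoc, List.singleton_append] at hl hd ⊢
      exact derives_replace_vert hq hK ha H hl hd

/-- Prefixes with equal invariants have the same accepted continuations. If `⊥` has not been read
in the current segment, this segment is replaced first, and then everything before it except for
the last vertical letter, which is the same on both sides. -/
theorem accept_of_invariant_eq (hq : IsQuery ar π G) (hK : Bounds π K)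
    {u u' : List (Omega π)} (h : invariant K u = invariant K u') (v : List (Omega π))
    (hv : u ++ v ∈ Accept π G) : u' ++ v ∈ Accept π G := by
  obtain ⟨ρ, y, rfl, hρ, hy⟩ := exists_horiz_vert v
  rw [hq.mem_accept_iff] at hv ⊢
  have hx := endsVert_closedPart u
  have hx' := endsVert_closedPart u'
  have hσ := horizSegment_openPart u
  have hσ' := horizSegment_openPart u'
  have hu := closedPart_append_openPart u
  have hu' := closedPart_append_openPart u'
  simp only [invariant, Prod.mk.injEq] at h
  generalize closedPart u = x at *
  generalize closedPart u' = x' at *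
  generalize openPart u = σ at *
  generalize openPart u' = σ' at *
  obtain ⟨⟨e1, e2, e3, e4, e5, e6⟩, e7, e8, e9, e10⟩ := h
  subst hu hu'
  rw [show (x ++ σ) ++ (ρ ++ y) = x ++ ((σ ++ ρ) ++ y) by simp] at hv
  rw [show (x' ++ σ') ++ (ρ ++ y) = x' ++ ((σ' ++ ρ) ++ y) by simp]
  obtain ⟨hc, hd⟩ := hv
  have hc' := correct_congr hx hx' hσ hσ' hρ hy e1.mp e4.mp e5 e6 e3.mp hc
  refine ⟨hc', ?_⟩
  have hbot := exists_mem_iff_of_markerCount_eq e5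
  have htop := exists_mem_iff_of_markerCount_eq e6
  by_cases hb : ∃ L ∈ σ, Symb.bot ∈ L
  · exact derives_replace_bot hq hK hx hx' hσ hσ' hρ hy hb (hbot.1 hb) htop e10 hc.letters hd
  · refine derives_replace_closed hq hK hx e7 e8 (fun L hL => ?_)
      (derives_replace_no_bot hq hK hx hσ hσ' hρ hy hb (mt hbot.2 hb) htop e9 hc.letters hd)
    rcases List.mem_append.1 hL with hL | hL
    · exact hc.letters L (List.mem_append.2 (.inl hL))
    · exact hc'.letters L (List.mem_append.2 (.inr hL))

/-! ### Counting -/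

theorem Rule.size_le_size {r : Rule R} (hr : r ∈ π) : r.size ≤ π.size :=
  Finset.single_le_sum (f := Rule.size) (fun _ _ => Nat.zero_le _) hr

theorem card_le_size (π : Program R) : π.card ≤ π.size := by
  rw [Finset.card_eq_sum_ones]
  exact Finset.sum_le_sum fun r _ => by unfold Rule.size; omega

theorem sum_args_le_size (r : Rule R) : (r.body.atoms.map fun a => a.args.length).sum ≤ r.size := by
  have : (r.body.atoms.map fun a => a.args.length).sum ≤ (r.body.atoms.map Atom.size).sum :=
    List.sum_le_sum fun a _ => by unfold Atom.size; omega
  unfold Rule.size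
  omega

/-- The variables of a body as a finite set. -/
def Body.varFinset (B : Body R) : Finset ℕ := (B.atoms.flatMap Atom.args).toFinset

theorem Body.mem_varFinset {B : Body R} {v : ℕ} : v ∈ B.varFinset ↔ v ∈ B.vars := by
  simp [Body.varFinset, Body.vars]

theorem card_varFinset_le (r : Rule R) : r.body.varFinset.card ≤ r.size := by
  refine le_trans (List.toFinset_card_le _) ?_
  rw [List.length_flatMap]
  exact sum_args_le_size r

/-- Paths in the Gaifman graph of a body have at most as many vertices as the body has
variables. -/
theorem bounds_size (hq : IsQuery ar π G) : Bounds π π.size where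
  shift := by
    intro r hr a ha
    have h1 : a.size ≤ (r.body.atoms.map Atom.size).sum :=
      List.single_le_sum (by simp) _ (List.mem_map_of_mem ha)
    have h2 := Rule.size_le_size hr
    unfold Rule.size Atom.size at *
    rw [Int.abs_eq_natAbs]
    omega
  dist := by
    intro r hr u v
    have : Fintype {v // v ∈ r.body.vars} :=
      Fintype.subtype r.body.varFinset fun v => Body.mem_varFinset
    obtain ⟨w, hw, hl⟩ := (hq.connected r hr).exists_path_of_dist u v
    have h1 := hw.length_lt
    have h2 : Fintype.card {v // v ∈ r.body.vars} = r.body.varFinset.card := by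
      rw [← Fintype.card_coe]
      exact Fintype.card_congr (Equiv.subtypeEquivRight fun v => Body.mem_varFinset.symm)
    have h3 := card_varFinset_le r
    have h4 := Rule.size_le_size hr
    omega

theorem card_subtype_le {α : Type*} {p : α → Prop} (s : Finset α) (h : ∀ a, p a → a ∈ s) :
    Finite {a // p a} ∧ Nat.card {a // p a} ≤ s.card := by
  have hi : Function.Injective fun a : {a // p a} => (⟨a.1, h a.1 a.2⟩ : s) :=
    fun a b e => Subtype.ext (congrArg (fun c : s => c.1) e)
  refine ⟨Finite.of_injective _ hi, ?_⟩
  have := Nat.card_le_card_of_injective _ hi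
  simpa using this

theorem card_bodyOf_le (π : Program R) : Finite (BodyOf π) ∧ Nat.card (BodyOf π) ≤ π.size := by
  classical
  obtain ⟨h1, h2⟩ := card_subtype_le (p := fun B => B ∈ π.bodies) (π.image Rule.body) (by
    rintro _ ⟨r, hr, rfl⟩
    exact Finset.mem_image_of_mem _ hr)
  exact ⟨h1, h2.trans (Finset.card_image_le.trans (card_le_size π))⟩

theorem card_idbOf_le (π : Program R) : Finite (IdbOf π) ∧ Nat.card (IdbOf π) ≤ π.size := by
  classical
  obtain ⟨h1, h2⟩ := card_subtype_le (p := π.IsIDB) (π.image Rule.head) (by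
    rintro _ ⟨r, hr, rfl⟩
    exact Finset.mem_image_of_mem _ hr)
  exact ⟨h1, h2.trans (Finset.card_image_le.trans (card_le_size π))⟩

theorem card_varOf_le (π : Program R) : Finite (VarOf π) ∧ Nat.card (VarOf π) ≤ π.size := by
  classical
  obtain ⟨h1, h2⟩ := card_subtype_le (p := fun v => ∃ r ∈ π, v ∈ r.body.vars)
    (π.biUnion fun r => r.body.varFinset) (by
      rintro v ⟨r, hr, hv⟩
      exact Finset.mem_biUnion.2 ⟨r, hr, Body.mem_varFinset.2 hv⟩)
  exact ⟨h1, h2.trans (Finset.card_biUnion_le.trans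
    (Finset.sum_le_sum fun r _ => card_varFinset_le r))⟩

theorem card_symb_le (π : Program R) : Finite (Symb π) ∧ Nat.card (Symb π) ≤ π.size + 2 := by
  obtain ⟨h1, h2⟩ := card_bodyOf_le π
  let f : Symb π → Option (Option (BodyOf π)) := fun s => match s with
    | .body B => some (some B)
    | .bot => none
    | .top => some none
  have hf : Function.Injective f := by
    rintro (_ | _ | _) (_ | _ | _) h <;> simp_all [f]
  refine ⟨Finite.of_injective f hf, ?_⟩
  have := Nat.card_le_card_of_injective f hf
  rw [Finite.card_option, Finite.card_option] at this
  omega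

theorem card_set (α : Type*) [Finite α] : Nat.card (Set α) = 2 ^ Nat.card α := by
  classical
  have := Fintype.ofFinite α
  simp [Nat.card_eq_fintype_card]

/-- A bound on the number of bits of `Data π K` for `K = |π|`, where `time`, `code` and `name`
bound the cardinalities of `RelTime K`, `Code π K` and `Name π K`. -/
def dataBits (s : ℕ) : ℕ :=
  let time := 40 * s + 1
  let code := (s + 2) * (time * (time * (s * s) + 1))
  let name := 2 * code + 1
  2 * ((s + 2) * (time * s)) + (s * name * (s * name) + (s * name + (name + time)))

theorem card_data_le (π : Program R) :
    Finite (Data π π.size) ∧ Nat.card (Data π π.size) ≤ 2 ^ dataBits π.size := by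
  obtain ⟨f1, h1⟩ := card_bodyOf_le π
  obtain ⟨f2, h2⟩ := card_idbOf_le π
  obtain ⟨f3, h3⟩ := card_varOf_le π
  refine ⟨inferInstance, ?_⟩
  have ht : Nat.card (RelTime π.size) = 40 * π.size + 1 := by
    rw [Nat.card_eq_fintype_card, Fintype.card_coe, Int.card_Icc]
    omega
  have hn : Nat.card (RelNode π.size) = π.size + 2 := by
    rw [Nat.card_eq_fintype_card, Fintype.card_coe, Int.card_Icc]
    omega
  simp only [Nat.card_prod, card_set, Finite.card_option, ht, hn, ← pow_add]
  refine Nat.pow_le_pow_right two_pos ?_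
  rw [show Nat.card Bool = 2 by simp]
  unfold dataBits
  simp only
  gcongr

/-- A bound on the number of bits of `Invariant π K` for `K = |π|`. -/
def invariantBits (s : ℕ) : ℕ := 8 + (s + 3 + (dataBits s + (dataBits s + dataBits s)))

theorem card_invariant_le (π : Program R) :
    Finite (Invariant π π.size) ∧ Nat.card (Invariant π π.size) ≤ 2 ^ invariantBits π.size := by
  obtain ⟨f1, h1⟩ := card_data_le π
  obtain ⟨f2, h2⟩ := card_symb_le π
  refine ⟨inferInstance, ?_⟩
  have h3 : Nat.card (Option (Omega π)) ≤ 2 ^ (π.size + 3) := by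
    rw [Finite.card_option, card_set, pow_succ]
    have : 2 ^ Nat.card (Symb π) ≤ 2 ^ (π.size + 2) := Nat.pow_le_pow_right two_pos h2
    have := Nat.one_le_two_pow (n := π.size + 2)
    omega
  have h4 : Nat.card (Prop × Prop × Prop × Prop × Fin 3 × Fin 3) ≤ 2 ^ 8 := by
    simp
  have h5 : (2 : ℕ) ^ invariantBits π.size = 2 ^ 8 * (2 ^ (π.size + 3) *
      (2 ^ dataBits π.size * (2 ^ dataBits π.size * 2 ^ dataBits π.size))) := by
    simp only [invariantBits, ← pow_add]
  rw [h5, Nat.card_prod]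
  refine Nat.mul_le_mul h4 ?_
  rw [Nat.card_prod]
  refine Nat.mul_le_mul h3 ?_
  rw [Nat.card_prod]
  refine Nat.mul_le_mul h1 ?_
  rw [Nat.card_prod]
  exact Nat.mul_le_mul h1 h1

/-- A finite invariant of prefixes that is compatible with a language yields a small automaton, by
the theorem of Myhill and Nerode. -/
theorem exists_nfa_of_invariant {α C : Type*} [Finite C] {L : Language α} (f : List α → C)
    (h : ∀ u u', f u = f u' → ∀ v, u ++ v ∈ L → u' ++ v ∈ L) :
    L.IsRegular ∧ ∃ (n : ℕ) (M : NFA α (Fin n)), M.accepts = L ∧ n ≤ Nat.card C := by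
  have hi : Function.Injective fun Q : Set.range L.leftQuotient => f Q.2.choose := by
    intro Q Q' e
    refine Subtype.ext ?_
    rw [← Q.2.choose_spec, ← Q'.2.choose_spec]
    ext v
    exact ⟨h _ _ e v, h _ _ e.symm v⟩
  have hfin : Finite (Set.range L.leftQuotient) := Finite.of_injective _ hi
  refine ⟨.of_finite_range_leftQuotient hfin, _,
    (DFA.reindex (Finite.equivFin (Set.range L.leftQuotient)) L.toDFA).toNFA, ?_,
    Nat.card_le_card_of_injective _ hi⟩
  rw [DFA.toNFA_correct, DFA.accepts_reindex, Language.accepts_toDFA]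

end TDatalog

theorem mainTheorem6 :
    ∃ p : ℕ[X], ∀ (R : Type*) (ar : R → ℕ) (π : TDatalog.Program R) (G : R),
      TDatalog.IsQuery ar π G →
        (TDatalog.NotAccept π G).IsRegular ∧
        (TDatalog.Accept π G).IsRegular ∧
        ∃ (n : ℕ) (M : NFA (TDatalog.Omega π) (Fin n)),
          M.accepts = TDatalog.NotAccept π G ∧
          n ≤ 2 ^ p.eval (TDatalog.Program.size π) := by
  let x : ℕ[X] := Polynomial.X
  let time : ℕ[X] := 40 * x + 1
  let code : ℕ[X] := (x + 2) * (time * (time * (x * x) + 1))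
  let name : ℕ[X] := 2 * code + 1
  let bits : ℕ[X] :=
    2 * ((x + 2) * (time * x)) + (x * name * (x * name) + (x * name + (name + time)))
  refine ⟨8 + (x + 3 + (bits + (bits + bits))), fun R ar π G hq => ?_⟩
  obtain ⟨hfin, hcard⟩ := TDatalog.card_invariant_le π
  have hinv : ∀ u u', TDatalog.invariant π.size u = TDatalog.invariant π.size u' →
      ∀ v, u ++ v ∈ TDatalog.NotAccept π G → u' ++ v ∈ TDatalog.NotAccept π G :=
    fun u u' e v hv hv' =>
      hv (TDatalog.accept_of_invariant_eq hq (TDatalog.bounds_size hq) e.symm v hv')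
  obtain ⟨hreg, n, M, hM, hn⟩ := TDatalog.exists_nfa_of_invariant _ hinv
  refine ⟨hreg, Language.IsRegular.of_compl hreg, n, M, hM, hn.trans (hcard.trans_eq ?_)⟩
  congr 1
  simp [x, bits, name, code, time, TDatalog.invariantBits, TDatalog.dataBits]
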